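/- Work over $\mathbb{C}$, let $S=\mathbb{C}[x,y,z]$ be the coordinate ring of $\mathbb{P}^2$, and for an ideal $I\subset S$ let $I_d=I\cap S_d$ be the space of forms of degree $d$ in $I$. A 2-square is a scheme $Z\subset\mathbb{P}^2$ with ideal $I(Z)=(L_1^2,L_2^2)$, where $L_1,L_2$ are linearly independent linear forms; it is supported at the point $P=\{L_1=L_2=0\}$. For a point $Q$ with homogeneous ideal $I(Q)$, the triple point $3Q$ is the scheme with ideal $I(Q)^3$. **Theorem.** For $s\ge 0$ let $X_s=Z_1+\dots+Z_s+3Q$ be a general union of $s$ 2-squares and one triple point, so that $I(X_s)=I(Z_1)\cap\dots\cap I(Z_s)\cap I(Q)^3$. Here "general" means: for each $s$ there is a nonempty Zariski open subset of the space of parameters (the pairs of lines defining $Z_1,\dots,Z_s$, and the point $Q$), independent of $d$, such that the following holds for every choice of parameters in it. For every $d\ge 0$ with $(s,d)\ne(1,3)$, $$\dim_{\mathbb{C}} I(X_s)_d=\max\left\{\binom{d+2}{2}-4s-6,\;0\right\}.$$ In the exceptional case $s=1$, $d=3$, for general $X_1=Z_1+3Q$ with $Z_1$ supported at $P_1$,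 one has $\dim_{\mathbb{C}} I(X_1)_3=1$ (instead of the expected value $0$), and $I(X_1)_3$ is spanned by $L^3$, where $L=0$ is the line through $P_1$ and $Q$. -/

import Mathlib

/-- The linear form `a₀ x + a₁ y + a₂ z` in `S = ℂ[x, y, z]`. -/
noncomputable def linearForm (a : Fin 3 → ℂ) : MvPolynomial (Fin 3) ℂ :=
  ∑ j, MvPolynomial.C (a j) * MvPolynomial.X j

/-- The ideal `(L₁², L₂²)` of the 2-square defined by the lines `L₁ = 0`, `L₂ = 0`,
given by the coefficient vectors `l 0`, `l 1` (which are to be linearly independent). -/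
noncomputable def twoSquareIdeal (l : Fin 2 → Fin 3 → ℂ) : Ideal (MvPolynomial (Fin 3) ℂ) :=
  Ideal.span {linearForm (l 0) ^ 2, linearForm (l 1) ^ 2}

/-- The homogeneous ideal `I(Q)` of the point `Q = [q]` of the projective plane (`q ≠ 0`):
all polynomials that vanish on the line `ℂ q` of `ℂ³`. -/
noncomputable def pointIdeal (q : Fin 3 → ℂ) : Ideal (MvPolynomial (Fin 3) ℂ) :=
  MvPolynomial.vanishingIdeal ℂ ((Submodule.span ℂ {q} : Submodule ℂ (Fin 3 → ℂ)) :
    Set (Fin 3 → ℂ))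

/-- The ideal `I(mQ) = I(Q)^m` of the `m`-fat point supported at `Q = [q]`. -/
noncomputable def fatPointIdeal (m : ℕ) (q : Fin 3 → ℂ) : Ideal (MvPolynomial (Fin 3) ℂ) :=
  pointIdeal q ^ m

/-- Homogeneous coordinates of `s` pairs of distinct lines of the projective plane
(the data of `s` 2-squares) and of a point `Q`. -/
structure Config (s : ℕ) where
  /-- `lines i 0` and `lines i 1` are the coefficients of the two lines of the `i`-th 2-square. -/
  lines : Fin s → Fin 2 → Fin 3 → ℂ
  lines_indep : ∀ i, LinearIndependent ℂ (lines i)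
  /-- Homogeneous coordinates of the point `Q`. -/
  Q : Fin 3 → ℂ
  Q_ne_zero : Q ≠ 0

namespace Config

/-- The list of all coordinates of a configuration, a point of `ℂ^(6s+3)`. -/
def coords {s : ℕ} (c : Config s) : (Fin s × Fin 2 × Fin 3) ⊕ Fin 3 → ℂ :=
  Sum.elim (fun p => c.lines p.1 p.2.1 p.2.2) c.Q

/-- Homogeneous coordinates of the support `P_i` of the `i`-th 2-square: the intersection point
of its two lines. -/
def support {s : ℕ} (c : Config s) (i : Fin s) : Fin 3 → ℂ :=
  crossProduct (c.lines i 0) (c.lines i 1)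

/-- The ideal `I(X_s)` of the scheme `X_s = Z_1 + ... + Z_s + 3Q`: a schematic union is defined
by the intersection of the ideals. -/
noncomputable def ideal {s : ℕ} (c : Config s) : Ideal (MvPolynomial (Fin 3) ℂ) :=
  (⨅ i, twoSquareIdeal (c.lines i)) ⊓ fatPointIdeal 3 c.Q

end Config

/-- The degree `d` part `I_d = I ∩ S_d` of an ideal `I` of `S`, as a complex vector space. -/
noncomputable def gradedPart (I : Ideal (MvPolynomial (Fin 3) ℂ)) (d : ℕ) :
    Submodule ℂ (MvPolynomial (Fin 3) ℂ) :=
  I.restrictScalars ℂ ⊓ MvPolynomial.homogeneousSubmodule (Fin 3) ℂ d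

/-- A property holds for the general configuration if it holds on a nonempty Zariski open subset
of the (irreducible) parameter space, that is, wherever some nonzero polynomial in the
coordinates of the configuration does not vanish. -/
def HoldsForGeneral {s : ℕ} (p : Config s → Prop) : Prop :=
  ∃ F : MvPolynomial ((Fin s × Fin 2 × Fin 3) ⊕ Fin 3) ℂ, F ≠ 0 ∧
    ∀ c : Config s, MvPolynomial.eval c.coords F ≠ 0 → p c

/-! The dimension in degree d is bounded below by counting: `Config.le_finrank_add` shows that four
coefficient conditions per 2-square and six for the triple point force a form into the ideal. For
the upper bound, differential functionals vanishing on the ideal form `Config.conditionMatrix`, and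
the dimension is at most the number of monomials minus its rank. The entries are polynomial in the
configuration, so a lower bound for the rank at one special configuration holds generically.

The special configuration has its triple point at [0:1:0], which removes exactly the monomials x^i
y^j z^(d-i-j) with j ≥ d-2. The 2-squares are torus translates of one fixed 2-square up to scaling;
on exponents (i, j) each gives, at its point (p, q), the functions p^i q^j times 1, i, j, i²+ij/2.
For (p, q) = (τ, τ^N) and τ → 0, suitably rescaled combinations tend to coordinate vectors of early
monomials in the order by rows. Since linear independence is an open condition, adding one 2-square
reduces to deleting four monomials (`ImposesConditions.peel`). On a row the weights restrict to
polynomials in i of degree at most 2, so at most three monomials are peeled there and the others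
come from the next row; `imposesConditions_truncatedTriangle` does the bookkeeping.

In degree 3 a single row of four monomials remains, so one 2-square gives only three conditions; the
cube of the line through both supports explains the defect. A single open set serves all degrees
because independence of the functionals persists from degree d to d+1 (`Config.IndependentIn.succ`),
leaving finitely many degrees to intersect. -/

open MvPolynomial Finset

/-! ### Peeling monomials by a torus degeneration -/

/-- The four conditions of a 2-square on the monomial with exponents `m`, up to scaling. -/
noncomputable def squareWeights (m : ℕ × ℕ) : Fin 4 → ℂ :=
  ![1, m.1, m.2, m.1 ^ 2 + m.1 * m.2 / 2]

/-- The conditions of a 2-square supported at the torus point `p` on the monomials. -/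
noncomputable def torusRow (p : ℂ × ℂ) (k : Fin 4) (m : ℕ × ℕ) : ℂ :=
  p.1 ^ m.1 * p.2 ^ m.2 * squareWeights m k

/-- Some `s` torus points impose at least `n` independent conditions on the monomials in `M`. -/
def ImposesConditions (M : Finset (ℕ × ℕ)) (n s : ℕ) : Prop :=
  ∃ pts : Fin s → ℂ × ℂ, (∀ i, (pts i).1 ≠ 0 ∧ (pts i).2 ≠ 0) ∧
    ∃ g : Fin n → ℕ × ℕ → ℂ,
      (∀ k, g k ∈ Submodule.span ℂ
        (Set.range fun r : Fin s × Fin 4 => torusRow (pts r.1) r.2)) ∧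
      LinearIndependent ℂ fun k (m : M) => g k m

theorem ImposesConditions.zero (M : Finset (ℕ × ℕ)) (s : ℕ) : ImposesConditions M 0 s :=
  ⟨fun _ => (1, 1), by simp, Fin.elim0, fun k => k.elim0, linearIndependent_empty_type⟩

/-- Restriction to `M'` kills the coordinate vectors and is injective on the span of `g`, so the two
spans meet only in zero. -/
theorem linearIndependent_sum_elim_single {M M' : Finset (ℕ × ℕ)} (hM : M' ⊆ M) {ι κ : Type*}
    {e : ι → M} (he : Function.Injective e) (hd : ∀ k, (e k : ℕ × ℕ) ∉ M')
    {g : κ → M → ℂ} (hg : LinearIndependent ℂ fun k (m : M') => g k ⟨m, hM m.2⟩) :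
    LinearIndependent ℂ (Sum.elim (fun k => (Pi.single (e k) (1 : ℂ) : M → ℂ)) g) := by
  let ρ : (M → ℂ) →ₗ[ℂ] (M' → ℂ) := LinearMap.funLeft ℂ ℂ fun m : M' => ⟨m, hM m.2⟩
  have hg' : LinearIndependent ℂ (ρ ∘ g) := hg
  refine LinearIndependent.sum_type ?_ hg'.of_comp ?_
  · have h := (Pi.basisFun ℂ M).linearIndependent.comp e he
    have h' : (fun k => (Pi.single (e k) (1 : ℂ) : M → ℂ)) = Pi.basisFun ℂ M ∘ e := by
      funext k
      simp
    rwa [h']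
  · refine (Submodule.range_ker_disjoint hg').symm.mono_left ?_
    rw [Submodule.span_le]
    rintro _ ⟨k, rfl⟩
    rw [SetLike.mem_coe, LinearMap.mem_ker]
    ext m
    have hne : (⟨m, hM m.2⟩ : M) ≠ e k := fun h => hd k (by rw [← h]; exact m.2)
    simp [ρ, LinearMap.funLeft_apply, Pi.single_eq_of_ne hne]

/-- The new point runs along the curve (τ, τ^N). Each combination `ψ k` is killed at every monomial
before `e k`, so after division by its leading term it tends to the coordinate vector of `e k`.
Independence at τ = 0 then holds for some small τ ≠ 0. -/
theorem ImposesConditions.peel {M M' : Finset (ℕ × ℕ)} {n s r : ℕ} (hM : M' ⊆ M)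
    (hn : ImposesConditions M' n s) (e : Fin r → ℕ × ℕ) (he : Function.Injective e)
    (heM : ∀ k, e k ∈ M) (heM' : ∀ k, e k ∉ M') (ψ : Fin r → Fin 4 → ℂ)
    (h1 : ∀ k, ψ k ⬝ᵥ squareWeights (e k) ≠ 0)
    (h2 : ∀ k, ∀ m ∈ M, m ≠ e k → ψ k ⬝ᵥ squareWeights m = 0 ∨
      (e k).2 < m.2 ∨ (e k).2 = m.2 ∧ (e k).1 < m.1) :
    ImposesConditions M (r + n) (s + 1) := by
  obtain ⟨pts, hpts, g, hg, hli⟩ := hn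
  -- With `N` above all first exponents, i + N j orders `M` by rows, then by columns.
  obtain ⟨N, hN⟩ : ∃ N, ∀ m ∈ M, m.1 < N :=
    ⟨M.sup Prod.fst + 1, fun m hm => Nat.lt_succ_of_le (Finset.le_sup (f := Prod.fst) hm)⟩
  let wt : ℕ × ℕ → ℕ := fun m => m.1 + N * m.2
  have hwt : ∀ b ∈ M, ∀ m : ℕ × ℕ, (b.2 < m.2 ∨ b.2 = m.2 ∧ b.1 < m.1) → wt b < wt m := by
    rintro b hb m (h | ⟨h, h'⟩)
    · have h3 : N * (b.2 + 1) ≤ N * m.2 := Nat.mul_le_mul_left N h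
      have := hN b hb
      simp only [wt]
      rw [mul_add, mul_one] at h3
      omega
    · simp only [wt, h]
      omega
  let c : Fin r → ℂ := fun k => ψ k ⬝ᵥ squareWeights (e k)
  -- The rescaled row, written without negative powers so that it is continuous at τ = 0; on `M`,
  -- the entries set to zero by the `else` branch vanish anyway by `h2`.
  let v : ℂ → Fin r → ℕ × ℕ → ℂ := fun τ k m =>
    if wt (e k) ≤ wt m then (c k)⁻¹ * (τ ^ (wt m - wt (e k)) * (ψ k ⬝ᵥ squareWeights m)) else 0
  let F : ℂ → Fin r ⊕ Fin n → M → ℂ := fun τ =>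
    Sum.elim (fun k m => v τ k m) (fun k m => g k m)
  have hcont : Continuous F := by
    refine continuous_pi fun k => continuous_pi fun m => ?_
    rcases k with k | k
    · simp only [F, Sum.elim_inl, v]
      split_ifs <;> fun_prop
    · simp only [F, Sum.elim_inr]
      fun_prop
  have h0 : F 0 = Sum.elim (fun k => (Pi.single ⟨e k, heM k⟩ (1 : ℂ) : M → ℂ))
      (fun k m => g k m) := by
    funext k m
    rcases k with k | k
    · simp only [F, Sum.elim_inl, v]
      by_cases hm : (m : ℕ × ℕ) = e k
      · have : m = ⟨e k, heM k⟩ := Subtype.ext hm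
        subst this
        simp [c, inv_mul_cancel₀ (h1 k)]
      · have hm' : m ≠ ⟨e k, heM k⟩ := fun h => hm (by rw [h])
        rw [Pi.single_eq_of_ne hm']
        rcases h2 k m m.2 hm with h | h
        · simp [h]
        · have := hwt (e k) (heM k) m h
          rw [if_pos this.le, zero_pow (by omega)]
          simp
    · rfl
  have hli0 : LinearIndependent ℂ (F 0) := by
    rw [h0]
    exact linearIndependent_sum_elim_single hM
      (fun a b h => he (congrArg Subtype.val h)) heM' hli
  have hev : ∀ᶠ τ in nhds (0 : ℂ), LinearIndependent ℂ (F τ) :=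
    hcont.continuousAt.eventually hli0.eventually
  obtain ⟨τ, hτ, hτ0⟩ : ∃ τ : ℂ, LinearIndependent ℂ (F τ) ∧ τ ≠ 0 :=
    ((hev.filter_mono nhdsWithin_le_nhds).and
      (self_mem_nhdsWithin (s := ({0}ᶜ : Set ℂ)))).exists
  let G : Fin r → ℕ × ℕ → ℂ := fun k =>
    ∑ i, ((c k)⁻¹ * (τ ^ wt (e k))⁻¹ * ψ k i) • torusRow (τ, τ ^ N) i
  have hG : ∀ k, ∀ m ∈ M, G k m = v τ k m := by
    intro k m hm
    have h3 : G k m = (c k)⁻¹ * (τ ^ wt (e k))⁻¹ * τ ^ wt m * (ψ k ⬝ᵥ squareWeights m) := by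
      simp only [G, Finset.sum_apply, Pi.smul_apply, smul_eq_mul, torusRow, dotProduct,
        Finset.mul_sum, wt, pow_add, pow_mul]
      exact Finset.sum_congr rfl fun i _ => by ring
    rw [h3]
    simp only [v]
    split_ifs with h
    · have h4 : τ ^ wt m = τ ^ wt (e k) * τ ^ (wt m - wt (e k)) := by
        rw [← pow_add, Nat.add_sub_cancel' h]
      rw [h4]
      have := pow_ne_zero (wt (e k)) hτ0
      field_simp
    · by_cases hme : m = e k
      · exact absurd (by rw [hme]) h
      rcases h2 k m hm hme with h5 | h5
      · simp [h5]
      · exact absurd (hwt (e k) (heM k) m h5).le h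
  refine ⟨Fin.cons (τ, τ ^ N) pts, ?_, Sum.elim G g ∘ finSumFinEquiv.symm, ?_, ?_⟩
  · intro i
    refine Fin.cases ?_ (fun i => ?_) i
    · simp [hτ0]
    · simpa using hpts i
  · intro k
    simp only [Function.comp_apply]
    rcases finSumFinEquiv.symm k with k | k
    · simp only [Sum.elim_inl, G]
      refine Submodule.sum_mem _ fun i _ => Submodule.smul_mem _ _ (Submodule.subset_span ?_)
      exact ⟨(0, i), by simp⟩
    · simp only [Sum.elim_inr]
      refine Submodule.span_mono ?_ (hg k)
      rintro _ ⟨⟨i, j⟩, rfl⟩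
      exact ⟨(i.succ, j), by simp⟩
  · have h5 : (fun k (m : M) => (Sum.elim G g ∘ finSumFinEquiv.symm) k m) =
        F τ ∘ (finSumFinEquiv.symm : Fin (r + n) → Fin r ⊕ Fin n) := by
      funext k m
      simp only [Function.comp_apply]
      rcases finSumFinEquiv.symm k with k | k
      · simp [F, hG k m m.2]
      · simp [F]
    rw [h5]
    exact hτ.comp _ finSumFinEquiv.symm.injective

/-! ### Exhausting the truncated triangle row by row -/

/-- The part of the triangle `i + j ≤ d`, without the corner `j ≥ d - 2`, that consists of the
columns `i ≥ a` of row `j`, the columns `i ≥ b` of row `j + 1`, and the rows above. -/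
def truncatedTriangle (d j a b : ℕ) : Finset (ℕ × ℕ) :=
  (range (d + 1) ×ˢ range (d + 1)).filter fun m => m.1 + m.2 ≤ d ∧ m.2 + 3 ≤ d ∧ j ≤ m.2 ∧
    (m.2 = j → a ≤ m.1) ∧ (m.2 = j + 1 → b ≤ m.1)

theorem mem_truncatedTriangle {d j a b : ℕ} {m : ℕ × ℕ} :
    m ∈ truncatedTriangle d j a b ↔ m.1 + m.2 ≤ d ∧ m.2 + 3 ≤ d ∧ j ≤ m.2 ∧
      (m.2 = j → a ≤ m.1) ∧ (m.2 = j + 1 → b ≤ m.1) := by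
  simp only [truncatedTriangle, Finset.mem_filter, Finset.mem_product, Finset.mem_range]
  omega

/-- Maximality of the number of conditions survives a step that removes four monomials, or one that
removes all that remain. -/
theorem ImposesConditions.peel_min {M M' : Finset (ℕ × ℕ)} {s r : ℕ}
    (hn : ImposesConditions M' (min #M' (4 * s)) s) (e : Fin r → ℕ × ℕ)
    (he : Function.Injective e) (hM : ∀ m, m ∈ M' ↔ m ∈ M ∧ ∀ k, m ≠ e k)
    (heM : ∀ k, e k ∈ M) (hr : r = 4 ∨ r ≤ 4 ∧ M' = ∅) (ψ : Fin r → Fin 4 → ℂ)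
    (h1 : ∀ k, ψ k ⬝ᵥ squareWeights (e k) ≠ 0)
    (h2 : ∀ k, ∀ m ∈ M, m ≠ e k → ψ k ⬝ᵥ squareWeights m = 0 ∨
      (e k).2 < m.2 ∨ (e k).2 = m.2 ∧ (e k).1 < m.1) :
    ImposesConditions M (min #M (4 * (s + 1))) (s + 1) := by
  have hsub : M' ⊆ M := fun m hm => ((hM m).1 hm).1
  have hcard : #M = r + #M' := by
    have h3 : M = M' ∪ univ.image e := by
      ext m
      simp only [mem_union, mem_image, mem_univ, true_and, hM]
      constructor
      · intro h
        by_cases h' : ∃ k, e k = m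
        · exact Or.inr h'
        · exact Or.inl ⟨h, fun k hk => h' ⟨k, hk.symm⟩⟩
      · rintro (h | ⟨k, rfl⟩)
        exacts [h.1, heM k]
    rw [h3, card_union_of_disjoint, card_image_of_injective _ he, card_univ, Fintype.card_fin,
      add_comm]
    rw [disjoint_left]
    intro m hm hm'
    obtain ⟨k, -, rfl⟩ := mem_image.1 hm'
    exact ((hM _).1 hm).2 k rfl
  have h4 := hn.peel hsub e he heM (fun k hk => ((hM _).1 hk).2 k rfl) ψ h1 h2
  have h5 : min #M (4 * (s + 1)) = r + min #M' (4 * s) := by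
    rcases hr with rfl | ⟨hr, rfl⟩
    · omega
    · simp at hcard ⊢
      omega
  rwa [h5]

/-- Peeling three monomials off a row and one off the next. -/
theorem ImposesConditions.peel_three_one {d j a b s : ℕ} (hj : j + 4 ≤ d) (ha : a + 2 + j ≤ d)
    (hb : b + j + 1 ≤ d) (hn : ImposesConditions (truncatedTriangle d j (a + 3) (b + 1))
      (min #(truncatedTriangle d j (a + 3) (b + 1)) (4 * s)) s) :
    ImposesConditions (truncatedTriangle d j a b)
      (min #(truncatedTriangle d j a b) (4 * (s + 1))) (s + 1) := by
  -- On row j the first three combinations are 1, i-a and (i-a)(i-a-1). The fourth is the second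
  -- exponent minus j; it kills all of row j, including the monomials left there.
  refine hn.peel_min ![(a, j), (a + 1, j), (a + 2, j), (b, j + 1)] ?_ ?_ ?_ (Or.inl rfl)
    ![![1, 0, 0, 0], ![-a, 1, 0, 0],
      ![a * (a + 1), -(2 * a + 1) - j / 2, 0, 1], ![-j, 0, 1, 0]] ?_ ?_
  · intro k l
    fin_cases k <;> fin_cases l <;> simp
  · rintro ⟨x, y⟩
    simp only [mem_truncatedTriangle, Fin.forall_fin_succ, Prod.ext_iff, ne_eq]
    simp
    omega
  · simp [mem_truncatedTriangle, Fin.forall_fin_succ]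
    omega
  · intro k
    fin_cases k <;> simp [squareWeights]
    ring_nf
    norm_num
  · rintro k ⟨x, y⟩ hm hne
    rw [mem_truncatedTriangle] at hm
    fin_cases k <;> simp [squareWeights] at hne hm ⊢
    · omega
    · by_cases h : y = j ∧ x = a
      · left; obtain ⟨rfl, rfl⟩ := h; ring
      · omega
    · by_cases h : y = j ∧ (x = a ∨ x = a + 1)
      · left
        obtain ⟨rfl, rfl | rfl⟩ := h <;> push_cast <;> ring
      · omega
    · by_cases h : y = j
      · left; subst h; ring
      · omega

/-- Peeling the last two monomials off a row and two off the next. -/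
theorem ImposesConditions.peel_two_two {d j b s : ℕ} (hj : j + 4 ≤ d)
    (hb : b + j + 2 ≤ d) (hn : ImposesConditions (truncatedTriangle d (j + 1) (b + 2) 0)
      (min #(truncatedTriangle d (j + 1) (b + 2) 0) (4 * s)) s) :
    ImposesConditions (truncatedTriangle d j (d - 1 - j) b)
      (min #(truncatedTriangle d j (d - 1 - j) b) (4 * (s + 1))) (s + 1) := by
  obtain ⟨a, ha⟩ : ∃ a, a = d - 1 - j := ⟨_, rfl⟩
  rw [← ha]
  -- The last combination interpolates: it vanishes at the first three peeled monomials.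
  refine hn.peel_min ![(a, j), (a + 1, j), (b, j + 1), (b + 1, j + 1)] ?_ ?_ ?_ (Or.inl rfl)
    ![![1, 0, 0, 0], ![-a, 1, 0, 0], ![-j, 0, 1, 0],
      ![a * (a + 1) - j * (-(b ^ 2 + b * (j + 1) / 2) + (2 * a + 1 + j / 2) * b - a * (a + 1)),
        -(2 * a + 1) - j / 2,
        -(b ^ 2 + b * (j + 1) / 2) + (2 * a + 1 + j / 2) * b - a * (a + 1), 1]] ?_ ?_
  · intro k l
    fin_cases k <;> fin_cases l <;> simp
  · rintro ⟨x, y⟩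
    simp only [mem_truncatedTriangle, Fin.forall_fin_succ, Prod.ext_iff, ne_eq]
    simp
    omega
  · simp [mem_truncatedTriangle, Fin.forall_fin_succ]
    omega
  · intro k
    fin_cases k <;> simp [squareWeights]
    intro h
    -- The value at the fourth monomial is 2(b-a)+1/2, never zero; this is what the coefficient 1/2
    -- of ij in the weights is for.
    have h3 : (((4 * b + 1 : ℕ) : ℤ) : ℂ) = ((4 * a : ℕ) : ℤ) := by
      push_cast
      linear_combination 2 * h
    have h4 := Int.cast_injective h3
    omega
  · rintro k ⟨x, y⟩ hm hne
    rw [mem_truncatedTriangle] at hm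
    fin_cases k <;> simp [squareWeights] at hne hm ⊢
    · omega
    · by_cases h : y = j ∧ x = a
      · left; obtain ⟨rfl, rfl⟩ := h; ring
      · omega
    · by_cases h : y = j
      · left; subst h; ring
      · omega
    · by_cases h : y = j ∧ (x = a ∨ x = a + 1)
      · left
        obtain ⟨rfl, rfl | rfl⟩ := h <;> push_cast <;> ring
      · by_cases h : y = j + 1 ∧ x = b
        · left
          obtain ⟨rfl, rfl⟩ := h
          push_cast
          ring
        · omega

/-- Peeling the last monomial off a row and three off the next. -/
theorem ImposesConditions.peel_one_three {d j b s : ℕ} (hj : j + 4 ≤ d)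
    (hb : b + j + 3 ≤ d) (hn : ImposesConditions (truncatedTriangle d (j + 1) (b + 3) 0)
      (min #(truncatedTriangle d (j + 1) (b + 3) 0) (4 * s)) s) :
    ImposesConditions (truncatedTriangle d j (d - j) b)
      (min #(truncatedTriangle d j (d - j) b) (4 * (s + 1))) (s + 1) := by
  obtain ⟨a, ha⟩ : ∃ a, a = d - j := ⟨_, rfl⟩
  rw [← ha]
  -- On row j+1 the last three combinations are 1, i-b and (i-b)(i-b-1); multiples of the second
  -- exponent minus (j+1) correct the latter two to vanish at (a, j).
  refine hn.peel_min ![(a, j), (b, j + 1), (b + 1, j + 1), (b + 2, j + 1)] ?_ ?_ ?_ (Or.inl rfl)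
    ![![1, 0, 0, 0], ![-j, 0, 1, 0], ![-b - (a - b) * (j + 1), 1, a - b, 0],
      ![b * (b + 1) - (j + 1) * ((a - b) * (a - b - 1) - a / 2), -(2 * b + 1) - (j + 1) / 2,
        (a - b) * (a - b - 1) - a / 2, 1]] ?_ ?_
  · intro k l
    fin_cases k <;> fin_cases l <;> simp
  · rintro ⟨x, y⟩
    simp only [mem_truncatedTriangle, Fin.forall_fin_succ, Prod.ext_iff, ne_eq]
    simp
    omega
  · simp [mem_truncatedTriangle, Fin.forall_fin_succ]
    omega
  · intro k
    fin_cases k <;> simp [squareWeights]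
    all_goals ring_nf
    all_goals norm_num
  · rintro k ⟨x, y⟩ hm hne
    rw [mem_truncatedTriangle] at hm
    fin_cases k <;> simp [squareWeights] at hne hm ⊢
    · omega
    · by_cases h : y = j
      · left; subst h; ring
      · omega
    · by_cases h : y = j ∧ x = a
      · left; obtain ⟨rfl, rfl⟩ := h; ring
      · by_cases h : y = j + 1 ∧ x = b
        · left; obtain ⟨rfl, rfl⟩ := h; push_cast; ring
        · omega
    · by_cases h : y = j ∧ x = a
      · left; obtain ⟨rfl, rfl⟩ := h; ring
      · by_cases h : y = j + 1 ∧ (x = b ∨ x = b + 1)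
        · left
          obtain ⟨rfl, rfl | rfl⟩ := h <;> push_cast <;> ring
        · omega

/-- Peeling at most three monomials, the end of the last row. -/
theorem ImposesConditions.peel_last_row {j a : ℕ} (ha : 1 ≤ a) (ha' : a ≤ 4) (b s : ℕ) :
    ImposesConditions (truncatedTriangle (j + 3) j a b)
      (min #(truncatedTriangle (j + 3) j a b) (4 * (s + 1))) (s + 1) := by
  obtain ⟨r, hr⟩ : ∃ r, r = 4 - a := ⟨_, rfl⟩
  refine (ImposesConditions.zero ∅ s).peel_min (M' := ∅) (r := r) (fun k => (a + k, j)) ?_ ?_ ?_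
    (Or.inr ⟨by omega, rfl⟩)
    (fun k => (![![1, 0, 0, 0], ![-a, 1, 0, 0],
      ![a * (a + 1), -(2 * a + 1) - j / 2, 0, 1], 0] : Fin 4 → Fin 4 → ℂ)
        (Fin.ofNat 4 k)) ?_ ?_
  · intro k l h
    simpa [Fin.ext_iff] using h
  · rintro ⟨x, y⟩
    simp [mem_truncatedTriangle]
    intro h1 h2 h3 h4 h5
    exact ⟨⟨⟨x - a, by omega⟩, by simp only; omega⟩, by omega⟩
  · intro k
    simp [mem_truncatedTriangle]
    omega
  · rintro ⟨k, hk⟩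
    have : k < 3 := by omega
    interval_cases k <;> simp [squareWeights, Fin.ofNat]
    ring_nf
    norm_num
  · rintro ⟨k, hk⟩ ⟨x, y⟩ hm hne
    rw [mem_truncatedTriangle] at hm
    have : k < 3 := by omega
    interval_cases k <;> simp [squareWeights, Fin.ofNat] at hne hm ⊢
    · omega
    · by_cases h : y = j ∧ x = a
      · left; obtain ⟨rfl, rfl⟩ := h; ring
      · omega
    · by_cases h : y = j ∧ (x = a ∨ x = a + 1)
      · left
        obtain ⟨rfl, rfl | rfl⟩ := h <;> push_cast <;> ring
      · omega

/-- Let x and y be the numbers of monomials left in rows j and j+1. Finishing row j takes ⌈x/3⌉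
squares, hence 4⌈x/3⌉ monomials from the two rows. The inequalities say that these exist, that row
j+1 is not emptied if it is not the last, and that at most three monomials survive if it is: the
last row d-3 has no successor, so a square can take only three from it. -/
theorem imposesConditions_truncatedTriangle (s : ℕ) : ∀ d j a b : ℕ,
    (j + 3 = d ∧ 1 ≤ a ∧ a ≤ 4 ∨
      j + 4 ≤ d ∧ a ≤ d - j ∧ b ≤ d - j ∧
        4 * ((d + 1 - j - a + 2) / 3) ≤ (d + 1 - j - a) + (d - j - b) ∧
        (j + 4 = d → (d + 1 - j - a) + (d - j - b) ≤ 4 * ((d + 1 - j - a + 2) / 3) + 3) ∧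
        (j + 5 ≤ d → 4 * ((d + 1 - j - a + 2) / 3) + 1 ≤ (d + 1 - j - a) + (d - j - b))) →
    ImposesConditions (truncatedTriangle d j a b)
      (min #(truncatedTriangle d j a b) (4 * s)) s := by
  induction s with
  | zero =>
    intro d j a b _
    simpa using ImposesConditions.zero _ 0
  | succ s ih =>
    rintro d j a b (⟨rfl, h1, h2⟩ | ⟨h1, h2, h3, h4, h5, h6⟩)
    · exact ImposesConditions.peel_last_row h1 h2 b s
    · obtain h | h | h | h : d + 1 - j - a ≥ 4 ∨ d + 1 - j - a = 3 ∨ a = d - 1 - j ∨ a = d - j := by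
        omega
      · exact ImposesConditions.peel_three_one h1 (by omega) (by omega)
          (ih d j (a + 3) (b + 1) (by omega))
      · refine ImposesConditions.peel_three_one h1 (by omega) (by omega) ?_
        have h7 : truncatedTriangle d j (a + 3) (b + 1) = truncatedTriangle d (j + 1) (b + 1) 0 := by
          ext m
          simp only [mem_truncatedTriangle]
          omega
        rw [h7]
        exact ih d (j + 1) (b + 1) 0 (by omega)
      · subst h
        exact ImposesConditions.peel_two_two h1 (by omega)
          (ih d (j + 1) (b + 2) 0 (by omega))
      · subst h
        exact ImposesConditions.peel_one_three h1 (by omega)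
          (ih d (j + 1) (b + 3) 0 (by omega))

/-- Only row 0 is present, where the weight j vanishes, so a square removes three of the four
monomials; a further square is needed for the last one. -/
theorem ImposesConditions.cubics {n s : ℕ} (hn : ImposesConditions (truncatedTriangle 3 0 3 0) n s) :
    ImposesConditions (truncatedTriangle 3 0 0 0) (3 + n) (s + 1) := by
  refine hn.peel (by decide) ![(0, 0), (1, 0), (2, 0)] (by decide) (by decide) (by decide)
    ![![1, 0, 0, 0], ![0, 1, 0, 0], ![0, -1, 0, 1]] ?_ ?_
  · intro k
    fin_cases k <;> simp [squareWeights]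
    norm_num
  · rintro k ⟨x, y⟩ hm hne
    rw [mem_truncatedTriangle] at hm
    fin_cases k <;> simp [squareWeights] at hne hm ⊢
    · omega
    · omega
    · by_cases h : y = 0 ∧ (x = 0 ∨ x = 1)
      · left
        obtain ⟨rfl, rfl | rfl⟩ := h <;> simp
      · omega

theorem imposesConditions_cubics : ImposesConditions (truncatedTriangle 3 0 0 0) 3 1 :=
  (ImposesConditions.zero _ 0).cubics

theorem imposesConditions_triangle {s d : ℕ} (h : (s, d) ≠ (1, 3)) :
    ImposesConditions (truncatedTriangle d 0 0 0)
      (min #(truncatedTriangle d 0 0 0) (4 * s)) s := by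
  rcases lt_trichotomy d 3 with hd | rfl | hd
  · have : truncatedTriangle d 0 0 0 = ∅ := by
      refine Finset.eq_empty_of_forall_notMem fun m hm => ?_
      have := (mem_truncatedTriangle.1 hm).2.1
      omega
    simpa [this] using ImposesConditions.zero ∅ s
  · match s with
    | 0 => simpa using ImposesConditions.zero _ 0
    | 1 => exact absurd rfl h
    | s + 2 =>
      have h1 := (ImposesConditions.peel_last_row (j := 0) (a := 3) (by omega) (by omega) 0 s).cubics
      have h2 : #(truncatedTriangle (0 + 3) 0 3 0) = 1 := by decide
      have h3 : #(truncatedTriangle 3 0 0 0) = 4 := by decide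
      rw [h2] at h1
      rw [h3]
      convert h1 using 1
      omega
  · exact imposesConditions_truncatedTriangle s d 0 0 0 (by omega)

/-! ### Differential conditions vanishing on the ideals -/

/-- The derivative in the direction `u`. -/
noncomputable def dirDeriv (u : Fin 3 → ℂ) :
    Derivation ℂ (MvPolynomial (Fin 3) ℂ) (MvPolynomial (Fin 3) ℂ) :=
  ∑ a, u a • pderiv a

theorem dirDeriv_apply (u : Fin 3 → ℂ) (f : MvPolynomial (Fin 3) ℂ) :
    dirDeriv u f = ∑ a, u a • pderiv a f := by
  simp [dirDeriv, Fin.sum_univ_three]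

theorem dirDeriv_X (u : Fin 3 → ℂ) (a : Fin 3) : dirDeriv u (X a) = C (u a) := by
  rw [dirDeriv_apply, Finset.sum_eq_single a]
  · simp [MvPolynomial.smul_eq_C_mul]
  · intro b _ hb
    rw [pderiv_X_of_ne hb.symm, smul_zero]
  · simp

theorem dirDeriv_linearForm (u a : Fin 3 → ℂ) : dirDeriv u (linearForm a) = C (a ⬝ᵥ u) := by
  simp [linearForm, dotProduct, Derivation.leibniz, dirDeriv_X, map_sum]

theorem eval_linearForm (p a : Fin 3 → ℂ) : eval p (linearForm a) = a ⬝ᵥ p := by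
  simp [linearForm, dotProduct, map_sum]

/-- The four linear conditions that a 2-square imposes. -/
noncomputable def squareFunctional (l : Fin 2 → Fin 3 → ℂ) :
    Fin 4 → MvPolynomial (Fin 3) ℂ →ₗ[ℂ] ℂ :=
  let ev := (aeval (R := ℂ) (crossProduct (l 0) (l 1))).toLinearMap
  let D := (dirDeriv (crossProduct (l 1) ![0, 0, 1])).toLinearMap
  let E := (dirDeriv (crossProduct (l 0) ![0, 0, 1])).toLinearMap
  ![ev, ev ∘ₗ D, ev ∘ₗ E, ev ∘ₗ D ∘ₗ E]

/-- The six linear conditions that a triple point imposes. -/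
noncomputable def tripleFunctional (q : Fin 3 → ℂ) :
    Fin 6 → MvPolynomial (Fin 3) ℂ →ₗ[ℂ] ℂ :=
  let ev := (aeval (R := ℂ) q).toLinearMap
  let D := (pderiv (R := ℂ) (0 : Fin 3)).toLinearMap
  let E := (pderiv (R := ℂ) (2 : Fin 3)).toLinearMap
  ![ev, ev ∘ₗ D, ev ∘ₗ E, ev ∘ₗ D ∘ₗ D, ev ∘ₗ D ∘ₗ E, ev ∘ₗ E ∘ₗ E]

/-- All the linear conditions that a configuration imposes. -/
noncomputable def Config.functional {s : ℕ} (c : Config s) :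
    (Fin s × Fin 4) ⊕ Fin 6 → MvPolynomial (Fin 3) ℂ →ₗ[ℂ] ℂ :=
  Sum.elim (fun r => squareFunctional (c.lines r.1) r.2) (tripleFunctional c.Q)

/-- The two derivations go in the directions of the points where the lines meet z = 0, so each kills
the form of its own line. The mixed derivative of a multiple of either square therefore still
vanishes at the support. If a line is z = 0 its direction degenerates to zero, which does no harm
here. -/
theorem squareFunctional_eq_zero {l : Fin 2 → Fin 3 → ℂ} {f : MvPolynomial (Fin 3) ℂ}
    (hf : f ∈ twoSquareIdeal l) (k : Fin 4) : squareFunctional l k f = 0 := by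
  obtain ⟨g, h, rfl⟩ := Ideal.mem_span_pair.1 hf
  have h0 : eval (crossProduct (l 0) (l 1)) (linearForm (l 0)) = 0 := by
    rw [eval_linearForm, dot_self_cross]
  have h1 : eval (crossProduct (l 0) (l 1)) (linearForm (l 1)) = 0 := by
    rw [eval_linearForm, dot_cross_self]
  have h2 : dirDeriv (crossProduct (l 0) ![0, 0, 1]) (linearForm (l 0)) = 0 := by
    rw [dirDeriv_linearForm, dot_self_cross, C_0]
  have h3 : dirDeriv (crossProduct (l 1) ![0, 0, 1]) (linearForm (l 1)) = 0 := by
    rw [dirDeriv_linearForm, dot_self_cross, C_0]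
  fin_cases k <;>
    simp [squareFunctional, Derivation.leibniz, Derivation.leibniz_pow, h0, h1, h2, h3]

theorem Derivation.map_mem_ideal_pow {R A : Type*} [CommRing R] [CommRing A] [Algebra R A]
    (D : Derivation R A A) {I : Ideal A} {n : ℕ} {f : A} (hf : f ∈ I ^ (n + 1)) :
    D f ∈ I ^ n := by
  induction n generalizing f with
  | zero => simp
  | succ n ih =>
    rw [pow_succ] at hf
    refine Submodule.mul_induction_on hf (fun g hg h hh => ?_) fun g h hg hh => ?_
    · rw [Derivation.leibniz, smul_eq_mul, smul_eq_mul]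
      refine Ideal.add_mem _ (Ideal.mul_mem_right _ _ hg) ?_
      rw [mul_comm, pow_succ]
      exact Ideal.mul_mem_mul (ih hg) hh
    · rw [map_add]
      exact Ideal.add_mem _ hg hh

theorem eval_eq_zero_of_mem_pointIdeal {q : Fin 3 → ℂ} {f : MvPolynomial (Fin 3) ℂ}
    (hf : f ∈ pointIdeal q) : eval q f = 0 := by
  have := (mem_vanishingIdeal_iff.1 hf) q (Submodule.mem_span_singleton_self q)
  simpa [MvPolynomial.coe_aeval_eq_eval] using this

theorem tripleFunctional_eq_zero {q : Fin 3 → ℂ} {f : MvPolynomial (Fin 3) ℂ}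
    (hf : f ∈ fatPointIdeal 3 q) (k : Fin 6) : tripleFunctional q k f = 0 := by
  have h0 : ∀ {n : ℕ} {g}, g ∈ pointIdeal q ^ (n + 1) → eval q g = 0 := fun hg =>
    eval_eq_zero_of_mem_pointIdeal (Ideal.pow_le_self (Nat.succ_ne_zero _) hg)
  have h1 : ∀ a, eval q (pderiv a f) = 0 := fun a =>
    h0 (n := 1) ((pderiv a).map_mem_ideal_pow hf)
  have h2 : ∀ a b, eval q (pderiv a (pderiv b f)) = 0 := fun a b =>
    h0 (n := 0) ((pderiv a).map_mem_ideal_pow ((pderiv b).map_mem_ideal_pow hf))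
  fin_cases k <;> simp [tripleFunctional, h0 (n := 2) hf, h1, h2]

theorem Config.functional_eq_zero {s : ℕ} {c : Config s} {f : MvPolynomial (Fin 3) ℂ}
    (hf : f ∈ c.ideal) (k : (Fin s × Fin 4) ⊕ Fin 6) : c.functional k f = 0 := by
  rcases k with k | k
  · exact squareFunctional_eq_zero ((Submodule.mem_iInf _).1 hf.1 k.1) k.2
  · exact tripleFunctional_eq_zero hf.2 k

/-! ### Polynomial dependence on the configuration -/

/-- A function of configurations that is given by a polynomial in the coordinates. -/
def IsPolynomial {s : ℕ} (φ : Config s → ℂ) : Prop :=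
  ∃ F : MvPolynomial ((Fin s × Fin 2 × Fin 3) ⊕ Fin 3) ℂ, ∀ c, φ c = eval c.coords F

namespace IsPolynomial

variable {s : ℕ}

theorem const (a : ℂ) : IsPolynomial fun _ : Config s => a := ⟨C a, by simp⟩

theorem add {φ ψ : Config s → ℂ} (hφ : IsPolynomial φ) (hψ : IsPolynomial ψ) :
    IsPolynomial fun c => φ c + ψ c := by
  obtain ⟨F, hF⟩ := hφ
  obtain ⟨G, hG⟩ := hψ
  exact ⟨F + G, by simp [hF, hG]⟩

theorem sub {φ ψ : Config s → ℂ} (hφ : IsPolynomial φ) (hψ : IsPolynomial ψ) :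
    IsPolynomial fun c => φ c - ψ c := by
  obtain ⟨F, hF⟩ := hφ
  obtain ⟨G, hG⟩ := hψ
  exact ⟨F - G, by simp [hF, hG]⟩

theorem mul {φ ψ : Config s → ℂ} (hφ : IsPolynomial φ) (hψ : IsPolynomial ψ) :
    IsPolynomial fun c => φ c * ψ c := by
  obtain ⟨F, hF⟩ := hφ
  obtain ⟨G, hG⟩ := hψ
  exact ⟨F * G, by simp [hF, hG]⟩

theorem sum {ι : Type*} {t : Finset ι} {φ : ι → Config s → ℂ} (hφ : ∀ i, IsPolynomial (φ i)) :
    IsPolynomial fun c => ∑ i ∈ t, φ i c := by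
  choose F hF using hφ
  exact ⟨∑ i ∈ t, F i, by simp [hF]⟩

theorem lines (i : Fin s) (j : Fin 2) (k : Fin 3) : IsPolynomial fun c => c.lines i j k :=
  ⟨X (Sum.inl (i, j, k)), by simp [Config.coords]⟩

theorem point (k : Fin 3) : IsPolynomial fun c : Config s => c.Q k :=
  ⟨X (Sum.inr k), by simp [Config.coords]⟩

theorem eval {p : Config s → Fin 3 → ℂ} (hp : ∀ k, IsPolynomial fun c => p c k)
    (f : MvPolynomial (Fin 3) ℂ) : IsPolynomial fun c => MvPolynomial.eval (p c) f := by
  induction f using MvPolynomial.induction_on with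
  | C a => simpa using const a
  | add f g hf hg => simpa using hf.add hg
  | mul_X f k hf => simpa using hf.mul (hp k)

theorem crossProduct {p q : Config s → Fin 3 → ℂ} (hp : ∀ k, IsPolynomial fun c => p c k)
    (hq : ∀ k, IsPolynomial fun c => q c k) (k : Fin 3) :
    IsPolynomial fun c => _root_.crossProduct (p c) (q c) k := by
  fin_cases k <;> simp only [cross_apply]
  · exact ((hp 1).mul (hq 2)).sub ((hp 2).mul (hq 1))
  · exact ((hp 2).mul (hq 0)).sub ((hp 0).mul (hq 2))
  · exact ((hp 0).mul (hq 1)).sub ((hp 1).mul (hq 0))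

theorem functional (k : (Fin s × Fin 4) ⊕ Fin 6) (f : MvPolynomial (Fin 3) ℂ) :
    IsPolynomial fun c : Config s => c.functional k f := by
  rcases k with ⟨i, k⟩ | k
  · have hP := crossProduct (lines i 0) (lines i 1)
    have hu := crossProduct (lines i 1) (fun k => const ((![0, 0, 1] : Fin 3 → ℂ) k))
    have hv := crossProduct (lines i 0) (fun k => const ((![0, 0, 1] : Fin 3 → ℂ) k))
    fin_cases k <;>
      simp [Config.functional, squareFunctional, dirDeriv_apply,
        map_sum]
    · exact eval hP f
    · exact sum fun a => (hu a).mul (eval hP _)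
    · exact sum fun a => (hv a).mul (eval hP _)
    · exact sum fun a => (hv a).mul (sum fun b => (hu b).mul (eval hP _))
  · fin_cases k <;>
      simp [Config.functional, tripleFunctional] <;>
      exact eval point _

end IsPolynomial

/-! ### The special configuration -/

/-- The exponents of `x` and `y` in the monomials of degree `d`. -/
def degPairs (d : ℕ) : Finset (ℕ × ℕ) :=
  (range (d + 1) ×ˢ range (d + 1)).filter fun m => m.1 + m.2 ≤ d

theorem mem_degPairs {d : ℕ} {m : ℕ × ℕ} : m ∈ degPairs d ↔ m.1 + m.2 ≤ d := by
  simp only [degPairs, Finset.mem_filter, Finset.mem_product, Finset.mem_range]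
  omega

theorem card_degPairs (d : ℕ) : #(degPairs d) = (d + 2).choose 2 := by
  have h : degPairs d = (range (d + 1)).biUnion antidiagonal := by
    ext m
    simp only [mem_degPairs, mem_biUnion, mem_range, HasAntidiagonal.mem_antidiagonal]
    exact ⟨fun h => ⟨m.1 + m.2, by omega, rfl⟩, fun ⟨_, h1, h2⟩ => by omega⟩
  rw [h, card_biUnion]
  · simp only [Finset.Nat.card_antidiagonal]
    rw [Nat.choose_two_right, ← Finset.sum_range_id, Finset.sum_range_succ' _ (d + 1)]
    rfl
  · intro a _ b _ hab
    rw [Function.onFun, disjoint_left]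
    intro m hm hm'
    rw [HasAntidiagonal.mem_antidiagonal] at hm hm'
    exact hab (hm.symm.trans hm')

/-- The monomial of degree `d` with given exponents of `x` and `y`. -/
noncomputable def degMonomial (d : ℕ) (m : ℕ × ℕ) : MvPolynomial (Fin 3) ℂ :=
  X 0 ^ m.1 * X 1 ^ m.2 * X 2 ^ (d - m.1 - m.2)

/-- The matrix of the linear conditions that a configuration imposes on forms of degree `d`. -/
noncomputable def Config.conditionMatrix {s : ℕ} (c : Config s) (d : ℕ) :
    Matrix ((Fin s × Fin 4) ⊕ Fin 6) (degPairs d) ℂ :=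
  Matrix.of fun k m => c.functional k (degMonomial d m)

/-- Two lines that meet in the point `[p : q : 1]`. -/
noncomputable def torusLines (p : ℂ × ℂ) : Fin 2 → Fin 3 → ℂ :=
  ![![0, -1, p.2], ![p.2 / 2, -p.1, p.1 * p.2 / 2]]

theorem crossProduct_torusLines (p : ℂ × ℂ) : crossProduct (torusLines p 0) (torusLines p 1) =
    ![p.2 / 2 * p.1, p.2 / 2 * p.2, p.2 / 2] := by
  ext k
  fin_cases k <;> simp [torusLines, cross_apply] <;> ring

theorem linearIndependent_torusLines {p : ℂ × ℂ} (hp : p.2 ≠ 0) :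
    LinearIndependent ℂ (torusLines p) := by
  have h := crossProduct_torusLines p
  have h1 : crossProduct (torusLines p 0) (torusLines p 1) ≠ 0 := by
    rw [h]
    intro h2
    have := congrFun h2 2
    simp [hp] at this
  rw [crossProduct_ne_zero_iff_linearIndependent] at h1
  have h2 : torusLines p = ![torusLines p 0, torusLines p 1] := by
    ext k
    fin_cases k <;> rfl
  rwa [h2]

/-- On monomials at a torus point, the directional derivatives become, up to scaling, the Euler
operators with eigenvalues i + j/2 and i; composing them gives i(i + j/2) - i. The power of `p.2 /
2` is due to the cross product being that multiple of (p, q, 1). -/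
theorem squareFunctional_torusLines (p : ℂ × ℂ) {d : ℕ} {m : ℕ × ℕ}
    (hm : m.1 + m.2 ≤ d) :
    let Λ := fun k => squareFunctional (torusLines p) k (degMonomial d m)
    Λ 0 = (p.2 / 2) ^ d * (p.1 ^ m.1 * p.2 ^ m.2) ∧
    (p.2 / 2) * Λ 1 = -(m.1 + m.2 / 2) * Λ 0 ∧
    (p.2 / 2 * p.1) * Λ 2 = -m.1 * Λ 0 ∧
    (p.2 / 2) * (p.2 / 2 * p.1) * Λ 3 = (m.1 ^ 2 - m.1 + m.1 * m.2 / 2) * Λ 0 := by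
  obtain ⟨i, j⟩ := m
  obtain ⟨k, rfl⟩ : ∃ k, d = i + j + k := ⟨d - (i + j), by simp only at hm; omega⟩
  obtain ⟨x, y⟩ := p
  have h1 : crossProduct (torusLines (x, y) 1) ![0, 0, 1] = ![-x, -y / 2, 0] := by
    ext k
    fin_cases k <;> simp [torusLines, cross_apply]
    ring
  have h2 : crossProduct (torusLines (x, y) 0) ![0, 0, 1] = ![-1, 0, 0] := by
    ext k
    fin_cases k <;> simp [torusLines, cross_apply]
  have h3 : i + j + k - i - j = k := by omega
  simp only [squareFunctional, crossProduct_torusLines, h1, h2, degMonomial, h3]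
  simp [Derivation.leibniz, Derivation.leibniz_pow, dirDeriv_X]
  rcases i with _ | _ | i <;> rcases j with _ | j <;> simp
  all_goals repeat' apply And.intro
  all_goals ring

/-- The exponents of `x` and `z` that the conditions of a triple point at `[0 : 1 : 0]` select. -/
def cornerExponents : Fin 6 → ℕ × ℕ := ![(0, 0), (1, 0), (0, 1), (2, 0), (1, 1), (0, 2)]

theorem tripleFunctional_degMonomial (d : ℕ) (m : ℕ × ℕ) (k : Fin 6) :
    tripleFunctional ![0, 1, 0] k (degMonomial d m) =
      if cornerExponents k = (m.1, d - m.1 - m.2) then (![1, 1, 1, 2, 1, 2] : Fin 6 → ℂ) k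
      else 0 := by
  obtain ⟨i, j⟩ := m
  simp only [degMonomial]
  generalize d - i - j = l
  rcases i with _ | _ | _ | i <;> rcases l with _ | _ | _ | l <;> fin_cases k <;>
    simp [tripleFunctional, cornerExponents, Derivation.leibniz, Derivation.leibniz_pow,
      pderiv_X]

theorem torusRow_mem_span {p : ℂ × ℂ} (hp1 : p.1 ≠ 0) (hp : p.2 ≠ 0) (d : ℕ) (k : Fin 4) :
    (fun m : degPairs d => torusRow p k m) ∈ Submodule.span ℂ
      (Set.range fun k (m : degPairs d) =>
        squareFunctional (torusLines p) k (degMonomial d m)) := by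
  rw [Submodule.mem_span_range_iff_exists_fun]
  have h0 : ((p.2 / 2) ^ d) ≠ 0 := pow_ne_zero _ (div_ne_zero hp two_ne_zero)
  -- These coefficients invert the triangular relations of `squareFunctional_torusLines`; in
  -- particular j = 2(i + j/2) - 2i.
  refine ⟨((p.2 / 2) ^ d)⁻¹ • (![![1, 0, 0, 0], ![0, 0, -(p.2 / 2 * p.1), 0],
    ![0, -p.2, 2 * (p.2 / 2 * p.1), 0],
    ![0, 0, -(p.2 / 2 * p.1), p.2 / 2 * (p.2 / 2 * p.1)]] : Fin 4 → Fin 4 → ℂ) k, ?_⟩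
  ext m
  obtain ⟨e0, e1, e2, e3⟩ := squareFunctional_torusLines p (mem_degPairs.1 m.2)
  generalize squareFunctional (torusLines p) 0 (degMonomial d m) = Λ0 at *
  simp only [Fin.sum_univ_four, Pi.add_apply, Pi.smul_apply, smul_eq_mul]
  rw [show torusRow p k m = ((p.2 / 2) ^ d)⁻¹ * (((p.2 / 2) ^ d * (p.1 ^ m.1.1 * p.2 ^ m.1.2)) *
    squareWeights m k) by rw [torusRow]; field_simp, ← e0]
  simp only [mul_assoc]
  simp only [← mul_add]
  congr 1
  fin_cases k <;> simp [squareWeights]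
  · linear_combination -e2
  · linear_combination -2 * e1 + 2 * e2
  · linear_combination e3 - e2

/-- At [0:1:0] the triple point supplies the coordinate vector of every corner monomial, and the
2-squares supply vectors that are independent after restriction away from the corner. -/
theorem Config.exists_le_rank_conditionMatrix {s d n : ℕ}
    (h : ImposesConditions (truncatedTriangle d 0 0 0) n s) :
    ∃ c : Config s, #((degPairs d).filter fun m => d ≤ m.2 + 2) + n ≤
      (c.conditionMatrix d).rank := by
  obtain ⟨pts, hpts, g, hg, hli⟩ := h
  let c : Config s := ⟨fun i => torusLines (pts i),
    fun i => linearIndependent_torusLines (hpts i).2, ![0, 1, 0], fun h => by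
      simpa using congrFun h 1⟩
  refine ⟨c, ?_⟩
  let e : {m // m ∈ (degPairs d).filter fun m => d ≤ m.2 + 2} → degPairs d :=
    fun m => ⟨m, (mem_filter.1 m.2).1⟩
  have hsub : truncatedTriangle d 0 0 0 ⊆ degPairs d := fun m hm =>
    mem_degPairs.2 (mem_truncatedTriangle.1 hm).1
  have hli' := linearIndependent_sum_elim_single hsub (e := e)
    (fun a b h => Subtype.ext (congrArg (fun x : degPairs d => (x : ℕ × ℕ)) h))
    (fun m hm => by
      have h1 := (mem_truncatedTriangle.1 hm).2.1
      have h2 := (mem_filter.1 m.2).2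
      simp only [e] at h1
      omega)
    (g := fun k m => g k m) hli
  rw [Matrix.rank_eq_finrank_span_row]
  have hcard := finrank_span_eq_card hli'
  rw [Fintype.card_sum, Fintype.card_coe, Fintype.card_fin] at hcard
  rw [← hcard]
  refine Submodule.finrank_mono ?_
  rw [Submodule.span_le]
  rintro _ ⟨m | k, rfl⟩
  · have h1 := (mem_filter.1 m.2).2
    have h2 := mem_degPairs.1 (mem_filter.1 m.2).1
    obtain ⟨k, hk⟩ : ∃ k, cornerExponents k = (m.1.1, d - m.1.1 - m.1.2) := by
      have : m.1.1 + (d - m.1.1 - m.1.2) ≤ 2 := by omega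
      generalize m.1.1 = i at *
      generalize d - i - m.1.2 = l at *
      have hi : i ≤ 2 := by omega
      have hl : l ≤ 2 := by omega
      interval_cases i <;> interval_cases l <;> first | omega | decide
    have h3 : (![1, 1, 1, 2, 1, 2] : Fin 6 → ℂ) k ≠ 0 := by fin_cases k <;> simp
    have h4 : (Pi.single (e m) 1 : degPairs d → ℂ) =
        ((![1, 1, 1, 2, 1, 2] : Fin 6 → ℂ) k)⁻¹ • (c.conditionMatrix d).row (Sum.inr k) := by
      ext m'
      simp only [Config.conditionMatrix, Matrix.row, Matrix.of_apply, Config.functional,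
        Sum.elim_inr, Pi.smul_apply, smul_eq_mul, c, tripleFunctional_degMonomial, hk]
      by_cases hm : m' = e m
      · subst hm
        simp [e, h3]
      · rw [Pi.single_eq_of_ne hm, if_neg, mul_zero]
        intro h5
        refine hm (Subtype.ext ?_)
        have h6 := mem_degPairs.1 m'.2
        simp only [Prod.mk.injEq] at h5
        simp only [e, Prod.ext_iff]
        omega
    rw [Sum.elim_inl, h4]
    exact Submodule.smul_mem _ _ (Submodule.subset_span ⟨_, rfl⟩)
  · rw [Sum.elim_inr]
    let ρ : (ℕ × ℕ → ℂ) →ₗ[ℂ] (degPairs d → ℂ) := LinearMap.funLeft ℂ ℂ Subtype.val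
    have h1 := Submodule.mem_map_of_mem (f := ρ) (hg k)
    rw [Submodule.map_span, ← Set.range_comp] at h1
    refine Submodule.span_le.2 ?_ h1
    rintro _ ⟨⟨i, j⟩, rfl⟩
    refine Submodule.span_mono ?_ (torusRow_mem_span (hpts i).1 (hpts i).2 d j)
    rintro _ ⟨l, rfl⟩
    exact ⟨Sum.inl (i, l), rfl⟩

theorem card_truncatedTriangle (d : ℕ) : #(truncatedTriangle d 0 0 0) +
    #((degPairs d).filter fun m => d ≤ m.2 + 2) = (d + 2).choose 2 := by
  rw [← card_degPairs, ← card_filter_add_card_filter_not (s := degPairs d) (fun m => d ≤ m.2 + 2),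
    add_comm]
  congr 2
  ext m
  simp only [mem_truncatedTriangle, mem_filter, mem_degPairs]
  omega

theorem card_corner (d : ℕ) (hd : 2 ≤ d) :
    #((degPairs d).filter fun m => d ≤ m.2 + 2) = 6 := by
  obtain ⟨e, rfl⟩ := Nat.exists_eq_add_of_le' hd
  have : ((degPairs (e + 2)).filter fun m => e + 2 ≤ m.2 + 2) =
      {(0, e), (0, e + 1), (0, e + 2), (1, e), (1, e + 1), (2, e)} := by
    ext ⟨i, j⟩
    simp only [mem_filter, mem_degPairs, mem_insert, mem_singleton, Prod.mk.injEq]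
    omega
  rw [this]
  simp

/-! ### Genericity and semicontinuity of the rank -/

theorem HoldsForGeneral.mono {s : ℕ} {p q : Config s → Prop} (h : HoldsForGeneral p)
    (hpq : ∀ c, p c → q c) : HoldsForGeneral q := by
  obtain ⟨F, hF, h⟩ := h
  exact ⟨F, hF, fun c hc => hpq c (h c hc)⟩

theorem HoldsForGeneral.finset_forall {s : ℕ} {ι : Type*} (t : Finset ι)
    {p : ι → Config s → Prop} (h : ∀ i ∈ t, HoldsForGeneral (p i)) :
    HoldsForGeneral fun c => ∀ i ∈ t, p i c := by
  choose! F hF h using h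
  refine ⟨∏ i ∈ t, F i, Finset.prod_ne_zero_iff.2 hF, fun c hc i hi => h i hi c ?_⟩
  rw [map_prod] at hc
  exact Finset.prod_ne_zero_iff.1 hc i hi

/-- The rank of a matrix with polynomial entries is lower semicontinuous. -/
theorem holdsForGeneral_le_rank {s n : ℕ} {κ τ : Type*} [Fintype κ] [Fintype τ]
    [DecidableEq κ] [DecidableEq τ]
    (A : Config s → Matrix κ τ ℂ) (hA : ∀ k t, IsPolynomial fun c => A c k t)
    {c₀ : Config s} (h : n ≤ (A c₀).rank) : HoldsForGeneral fun c => n ≤ (A c).rank := by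
  -- Constant matrices `B` and `C` compress `A c₀` to the identity; the determinant of `B * A c * C`
  -- is then a polynomial in the coordinates, nonzero at `c₀`, and replaces the choice of a minor.
  obtain ⟨B, C, hBC⟩ : ∃ (B : Matrix (Fin n) κ ℂ) (C : Matrix τ (Fin n) ℂ), B * A c₀ * C = 1 := by
    obtain ⟨f, hf⟩ := exists_linearIndependent_of_le_finrank h
    choose x hx using fun k => (f k).2
    let C : Matrix τ (Fin n) ℂ := Matrix.of fun t k => x k t
    have hli : LinearIndependent ℂ (A c₀ * C).col := by
      have h1 := hf.map' (LinearMap.range (A c₀).mulVecLin).subtype (Submodule.ker_subtype _)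
      have h2 : (A c₀ * C).col = (LinearMap.range (A c₀).mulVecLin).subtype ∘ f := by
        ext k i
        simp only [Function.comp_apply, Submodule.subtype_apply, ← hx]
        rfl
      rwa [h2]
    rw [← Matrix.mulVec_injective_iff] at hli
    obtain ⟨g, hg⟩ := LinearMap.exists_leftInverse_of_injective (A c₀ * C).mulVecLin
      (LinearMap.ker_eq_bot.2 hli)
    refine ⟨LinearMap.toMatrix' g, C, ?_⟩
    have h2 := congrArg LinearMap.toMatrix' hg
    rw [LinearMap.toMatrix'_comp, LinearMap.toMatrix'_id, ← Matrix.toLin'_apply',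
      LinearMap.toMatrix'_toLin'] at h2
    rw [Matrix.mul_assoc]
    exact h2
  choose F hF using hA
  let B' : Matrix (Fin n) κ (MvPolynomial ((Fin s × Fin 2 × Fin 3) ⊕ Fin 3) ℂ) :=
    B.map MvPolynomial.C
  let A' : Matrix κ τ (MvPolynomial ((Fin s × Fin 2 × Fin 3) ⊕ Fin 3) ℂ) := Matrix.of F
  let C' : Matrix τ (Fin n) (MvPolynomial ((Fin s × Fin 2 × Fin 3) ⊕ Fin 3) ℂ) :=
    C.map MvPolynomial.C
  let M : Matrix (Fin n) (Fin n) (MvPolynomial ((Fin s × Fin 2 × Fin 3) ⊕ Fin 3) ℂ) :=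
    B' * A' * C'
  have hM : ∀ c : Config s, eval c.coords M.det = (B * A c * C).det := by
    intro c
    rw [RingHom.map_det]
    congr 1
    simp only [M, A', B', C', RingHom.mapMatrix_apply, Matrix.map_mul]
    congr 2
    · ext; simp
    · ext k t
      simp [hF]
    · ext; simp
  refine ⟨M.det, fun h0 => ?_, fun c hc => ?_⟩
  · have := hM c₀
    rw [h0, hBC] at this
    simp at this
  · rw [hM] at hc
    have h1 : (B * A c * C).rank = n := by
      rw [Matrix.rank_of_isUnit _ ((Matrix.isUnit_iff_isUnit_det _).2 (isUnit_iff_ne_zero.2 hc)),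
        Fintype.card_fin]
    rw [← h1]
    exact (Matrix.rank_mul_le_left _ _).trans (Matrix.rank_mul_le_right _ _)

theorem Config.holdsForGeneral_le_rank {s d n : ℕ}
    (h : ImposesConditions (truncatedTriangle d 0 0 0) n s) :
    HoldsForGeneral fun c : Config s =>
      #((degPairs d).filter fun m => d ≤ m.2 + 2) + n ≤ (c.conditionMatrix d).rank := by
  obtain ⟨c₀, hc₀⟩ := Config.exists_le_rank_conditionMatrix h
  exact _root_.holdsForGeneral_le_rank (fun c => c.conditionMatrix d)
    (fun k m => IsPolynomial.functional k _) hc₀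

/-! ### Coefficient vectors and the upper bound for the dimension -/

/-- The exponents of `x^i y^j z^(d-i-j)`. -/
noncomputable def degExponent (d : ℕ) (m : ℕ × ℕ) : Fin 3 →₀ ℕ :=
  Finsupp.equivFunOnFinite.symm ![m.1, m.2, d - m.1 - m.2]

theorem degMonomial_eq_monomial (d : ℕ) (m : ℕ × ℕ) :
    degMonomial d m = monomial (degExponent d m) 1 := by
  rw [degMonomial, monomial_eq, Finsupp.prod_fintype _ _ (by simp)]
  simp [Fin.prod_univ_three, degExponent]

theorem degExponent_injOn {d : ℕ} {m m' : ℕ × ℕ} (h : degExponent d m = degExponent d m') :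
    m = m' := by
  have h0 := DFunLike.congr_fun h 0
  have h1 := DFunLike.congr_fun h 1
  simp [degExponent] at h0 h1
  exact Prod.ext h0 h1

/-- The form of degree `d` with given coefficients. -/
noncomputable def formOfCoeffs (d : ℕ) : (degPairs d → ℂ) →ₗ[ℂ] MvPolynomial (Fin 3) ℂ :=
  Fintype.linearCombination ℂ fun m : degPairs d => degMonomial d m

/-- The coefficients of degree `d` of a polynomial. -/
noncomputable def formCoeffs (d : ℕ) : MvPolynomial (Fin 3) ℂ →ₗ[ℂ] (degPairs d → ℂ) :=
  LinearMap.pi fun m => lcoeff ℂ (degExponent d m)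

theorem formCoeffs_formOfCoeffs {d : ℕ} (v : degPairs d → ℂ) :
    formCoeffs d (formOfCoeffs d v) = v := by
  ext m
  simp only [formCoeffs, formOfCoeffs, LinearMap.pi_apply, lcoeff_apply,
    Fintype.linearCombination_apply, coeff_sum, coeff_smul, degMonomial_eq_monomial,
    coeff_monomial]
  rw [Finset.sum_eq_single m]
  · simp
  · intro b _ hb
    rw [if_neg, smul_zero]
    exact fun h => hb (Subtype.ext (degExponent_injOn h))
  · simp

theorem degMonomial_isHomogeneous {d : ℕ} (m : degPairs d) :
    (degMonomial d m).IsHomogeneous d := by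
  rw [degMonomial_eq_monomial]
  refine isHomogeneous_monomial _ ?_
  have := mem_degPairs.1 m.2
  rw [Finsupp.degree_eq_sum]
  simp [Fin.sum_univ_three, degExponent]
  omega

theorem formOfCoeffs_isHomogeneous {d : ℕ} (v : degPairs d → ℂ) :
    (formOfCoeffs d v).IsHomogeneous d := by
  rw [formOfCoeffs, Fintype.linearCombination_apply]
  refine IsHomogeneous.sum _ _ _ fun m _ => ?_
  rw [smul_eq_C_mul]
  exact (degMonomial_isHomogeneous m).C_mul _

theorem formOfCoeffs_formCoeffs {d : ℕ} {f : MvPolynomial (Fin 3) ℂ} (hf : f.IsHomogeneous d) :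
    formOfCoeffs d (formCoeffs d f) = f := by
  ext a
  by_cases ha : a.degree = d
  · rw [Finsupp.degree_eq_sum, Fin.sum_univ_three] at ha
    let m : degPairs d := ⟨(a 0, a 1), mem_degPairs.2 (by simp only; omega)⟩
    have hm : a = degExponent d m := by
      ext k
      fin_cases k <;> simp [degExponent, m]
      omega
    have := congrFun (formCoeffs_formOfCoeffs (formCoeffs d f)) m
    simp only [formCoeffs, LinearMap.pi_apply, lcoeff_apply, ← hm] at this
    exact this
  · rw [hf.coeff_eq_zero ha, (formOfCoeffs_isHomogeneous _).coeff_eq_zero ha]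

theorem Config.conditionMatrix_mulVec {s : ℕ} (c : Config s) {d : ℕ} (v : degPairs d → ℂ)
    (k : (Fin s × Fin 4) ⊕ Fin 6) :
    ((c.conditionMatrix d).mulVec v) k = c.functional k (formOfCoeffs d v) := by
  simp only [Config.conditionMatrix, Matrix.mulVec, dotProduct, Matrix.of_apply, formOfCoeffs,
    Fintype.linearCombination_apply, map_sum, map_smul, smul_eq_mul]
  exact Finset.sum_congr rfl fun m _ => mul_comm _ _

theorem formCoeffs_injective_gradedPart (I : Ideal (MvPolynomial (Fin 3) ℂ)) (d : ℕ) :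
    Function.Injective ((formCoeffs d).domRestrict (gradedPart I d)) := by
  rintro ⟨f, hf⟩ ⟨g, hg⟩ h
  have hf' : f.IsHomogeneous d := (mem_homogeneousSubmodule d f).1 hf.2
  have hg' : g.IsHomogeneous d := (mem_homogeneousSubmodule d g).1 hg.2
  simp only [LinearMap.domRestrict_apply] at h
  refine Subtype.ext ?_
  exact (formOfCoeffs_formCoeffs hf').symm.trans
    ((congrArg _ h).trans (formOfCoeffs_formCoeffs hg'))

instance (I : Ideal (MvPolynomial (Fin 3) ℂ)) (d : ℕ) : Module.Finite ℂ (gradedPart I d) :=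
  Module.Finite.of_injective _ (formCoeffs_injective_gradedPart I d)

/-- The graded part embeds in the kernel of the matrix. Equality is not claimed, since the
functionals may degenerate for special lines. -/
theorem Config.finrank_add_rank_le {s : ℕ} (c : Config s) (d : ℕ) :
    Module.finrank ℂ (gradedPart c.ideal d) + (c.conditionMatrix d).rank ≤ (d + 2).choose 2 := by
  have h1 := (c.conditionMatrix d).mulVecLin.finrank_range_add_finrank_ker
  rw [Module.finrank_fintype_fun_eq_card, Fintype.card_coe, card_degPairs] at h1
  rw [← h1, add_comm, Matrix.rank]
  refine Nat.add_le_add_left ?_ _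
  refine LinearMap.finrank_le_finrank_of_injective
    (f := ((formCoeffs d).domRestrict (gradedPart c.ideal d)).codRestrict _ ?_) ?_
  · rintro ⟨f, hf⟩
    rw [LinearMap.mem_ker]
    ext k
    rw [Matrix.mulVecLin_apply, c.conditionMatrix_mulVec, LinearMap.domRestrict_apply,
      formOfCoeffs_formCoeffs ((mem_homogeneousSubmodule d f).1 hf.2)]
    exact Config.functional_eq_zero hf.1 k
  · exact fun a b h => formCoeffs_injective_gradedPart _ d (congrArg Subtype.val h)

/-! ### The lower bound for the dimension -/

theorem linearForm_isHomogeneous (a : Fin 3 → ℂ) : (linearForm a).IsHomogeneous 1 :=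
  IsHomogeneous.sum _ _ _ fun j _ => by
    simpa using (isHomogeneous_C (Fin 3) (a j)).mul (isHomogeneous_X ℂ j)

/-- A linear change of coordinates that takes `x` and `y` to given independent linear forms. -/
theorem exists_coordinate_change {α β : Fin 3 → ℂ} (h : crossProduct α β ≠ 0) :
    ∃ σ τ : MvPolynomial (Fin 3) ℂ →ₐ[ℂ] MvPolynomial (Fin 3) ℂ,
      σ (X 0) = linearForm α ∧ σ (X 1) = linearForm β ∧ (∀ f, σ (τ f) = f) ∧
      ∀ d f, f.IsHomogeneous d → (τ f).IsHomogeneous d := by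
  obtain ⟨k, hk⟩ : ∃ k, crossProduct α β k ≠ 0 := Function.ne_iff.1 h
  let A : Matrix (Fin 3) (Fin 3) ℂ := Matrix.of ![α, β, Pi.single k 1]
  have hA : A.det = crossProduct α β k := by
    fin_cases k <;> simp [A, Matrix.det_fin_three, cross_apply]
    ring
  have hinv : A⁻¹ * A = 1 := Matrix.nonsing_inv_mul A (by rw [hA]; exact isUnit_iff_ne_zero.2 hk)
  refine ⟨aeval fun k => linearForm (A k), aeval fun k => linearForm (A⁻¹ k), ?_, ?_, ?_, ?_⟩
  · simp only [aeval_X]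
    rfl
  · simp only [aeval_X]
    rfl
  · intro f
    rw [← AlgHom.comp_apply]
    refine DFunLike.congr_fun (g := AlgHom.id ℂ _) (algHom_ext fun k => ?_) f
    have h1 : ∀ i, ∑ j, A⁻¹ k j * A j i = (1 : Matrix (Fin 3) (Fin 3) ℂ) k i := fun i => by
      rw [← hinv, Matrix.mul_apply]
    simp only [AlgHom.comp_apply, aeval_X, AlgHom.id_apply]
    simp only [linearForm, map_sum, map_mul, algHom_C, aeval_X, algebraMap_eq, Finset.mul_sum]
    rw [Finset.sum_comm]
    simp only [← mul_assoc, ← C_mul, ← Finset.sum_mul, ← map_sum, h1]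
    simp [Matrix.one_apply]
  · intro d f hf
    have := hf.aeval (fun k => linearForm (A⁻¹ k)) (n := 1) fun k => linearForm_isHomogeneous _
    rwa [one_mul] at this

/-- In coordinates where the two forms are x and y, it suffices that the coefficients at the
finitely many exponents `e k` vanish, as all other monomials lie in `I`. This works for every
configuration, unlike the differential functionals. -/
theorem exists_conditions {α β : Fin 3 → ℂ} (h : crossProduct α β ≠ 0)
    {I : Ideal (MvPolynomial (Fin 3) ℂ)} {n : ℕ} (e : Fin n → ℕ × ℕ)
    (hI : ∀ m : ℕ × ℕ, (∀ k, e k ≠ m) → linearForm α ^ m.1 * linearForm β ^ m.2 ∈ I) (d : ℕ) :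
    ∃ κ : MvPolynomial (Fin 3) ℂ →ₗ[ℂ] (Fin n → ℂ),
      ∀ f : MvPolynomial (Fin 3) ℂ, f.IsHomogeneous d → κ f = 0 → f ∈ I := by
  obtain ⟨σ, τ, h0, h1, hστ, hτ⟩ := exists_coordinate_change h
  refine ⟨(LinearMap.pi fun k => lcoeff ℂ (degExponent d (e k))) ∘ₗ τ.toLinearMap,
    fun f hf hκ => ?_⟩
  rw [← hστ f, ← formOfCoeffs_formCoeffs (hτ d f hf), formOfCoeffs,
    Fintype.linearCombination_apply, map_sum]
  refine Ideal.sum_mem _ fun m _ => ?_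
  rw [map_smul]
  by_cases hm : ∀ k, e k ≠ m
  · refine Submodule.smul_of_tower_mem I _ ?_
    rw [degMonomial, map_mul, map_mul, map_pow, map_pow, h0, h1]
    exact Ideal.mul_mem_right _ _ (hI _ hm)
  · push Not at hm
    obtain ⟨k, hk⟩ := hm
    have h2 : formCoeffs d (τ f) m = 0 := by
      have := congrFun hκ k
      change coeff (degExponent d (e k)) (τ f) = 0 at this
      rw [hk] at this
      exact this
    rw [h2, zero_smul]
    exact I.zero_mem

theorem twoSquareIdeal_conditions {l : Fin 2 → Fin 3 → ℂ} (hl : LinearIndependent ℂ l) (d : ℕ) :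
    ∃ κ : MvPolynomial (Fin 3) ℂ →ₗ[ℂ] (Fin 4 → ℂ),
      ∀ f : MvPolynomial (Fin 3) ℂ, f.IsHomogeneous d → κ f = 0 → f ∈ twoSquareIdeal l := by
  have hl' : crossProduct (l 0) (l 1) ≠ 0 := by
    rw [crossProduct_ne_zero_iff_linearIndependent]
    have h2 : l = ![l 0, l 1] := by
      ext k
      fin_cases k <;> rfl
    rwa [← h2]
  refine exists_conditions hl' ![(0, 0), (1, 0), (0, 1), (1, 1)] (fun m hm => ?_) d
  have h0 : linearForm (l 0) ^ 2 ∈ twoSquareIdeal l := Ideal.subset_span (by simp)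
  have h1 : linearForm (l 1) ^ 2 ∈ twoSquareIdeal l := Ideal.subset_span (by simp)
  have hm' : 2 ≤ m.1 ∨ 2 ≤ m.2 := by
    obtain ⟨i, j⟩ := m
    simp [Fin.forall_fin_succ] at hm
    simp only
    omega
  rcases hm' with h | h
  · exact Ideal.mul_mem_right _ _ (Ideal.pow_mem_of_pow_mem _ h0 h)
  · exact Ideal.mul_mem_left _ _ (Ideal.pow_mem_of_pow_mem _ h1 h)

theorem linearForm_mem_pointIdeal {a q : Fin 3 → ℂ} (h : a ⬝ᵥ q = 0) :
    linearForm a ∈ pointIdeal q := by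
  refine mem_vanishingIdeal_iff.2 fun x hx => ?_
  obtain ⟨t, rfl⟩ := Submodule.mem_span_singleton.1 hx
  exact (eval_linearForm _ _).trans (by rw [dotProduct_smul, h, smul_zero])

theorem exists_two_lines_through {q : Fin 3 → ℂ} (hq : q ≠ 0) :
    ∃ α β : Fin 3 → ℂ, crossProduct α β ≠ 0 ∧ α ⬝ᵥ q = 0 ∧ β ⬝ᵥ q = 0 := by
  obtain ⟨k, hk⟩ : ∃ k, q k ≠ 0 := Function.ne_iff.1 hq
  fin_cases k
  · refine ⟨![q 1, -q 0, 0], ![q 2, 0, -q 0], Function.ne_iff.2 ⟨0, ?_⟩, ?_, ?_⟩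
    · simpa [cross_apply] using hk
    · simp [dotProduct, Fin.sum_univ_three]; ring
    · simp [dotProduct, Fin.sum_univ_three]; ring
  · refine ⟨![-q 1, q 0, 0], ![0, q 2, -q 1], Function.ne_iff.2 ⟨1, ?_⟩, ?_, ?_⟩
    · simpa [cross_apply] using hk
    · simp [dotProduct, Fin.sum_univ_three]; ring
    · simp [dotProduct, Fin.sum_univ_three]; ring
  · refine ⟨![-q 2, 0, q 0], ![0, -q 2, q 1], Function.ne_iff.2 ⟨2, ?_⟩, ?_, ?_⟩
    · simpa [cross_apply] using hk
    · simp [dotProduct, Fin.sum_univ_three]; ring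
    · simp [dotProduct, Fin.sum_univ_three]; ring

theorem fatPointIdeal_conditions {q : Fin 3 → ℂ} (hq : q ≠ 0) (d : ℕ) :
    ∃ κ : MvPolynomial (Fin 3) ℂ →ₗ[ℂ] (Fin 6 → ℂ),
      ∀ f : MvPolynomial (Fin 3) ℂ, f.IsHomogeneous d → κ f = 0 → f ∈ fatPointIdeal 3 q := by
  obtain ⟨α, β, h, hα, hβ⟩ := exists_two_lines_through hq
  refine exists_conditions h cornerExponents (fun m hm => ?_) d
  have hm' : 3 ≤ m.1 + m.2 := by
    obtain ⟨i, j⟩ := m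
    simp [Fin.forall_fin_succ, cornerExponents] at hm
    simp only
    omega
  refine Ideal.pow_le_pow_right hm' ?_
  rw [pow_add]
  exact Ideal.mul_mem_mul (Ideal.pow_mem_pow (linearForm_mem_pointIdeal hα) _)
    (Ideal.pow_mem_pow (linearForm_mem_pointIdeal hβ) _)

theorem Config.le_finrank_add {s : ℕ} (c : Config s) (d : ℕ) :
    (d + 2).choose 2 ≤ Module.finrank ℂ (gradedPart c.ideal d) + (4 * s + 6) := by
  choose κ hκ using fun i => twoSquareIdeal_conditions (c.lines_indep i) d
  obtain ⟨μ, hμ⟩ := fatPointIdeal_conditions c.Q_ne_zero d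
  let K : (degPairs d → ℂ) →ₗ[ℂ] (Fin s → Fin 4 → ℂ) × (Fin 6 → ℂ) :=
    ((LinearMap.pi κ).prod μ) ∘ₗ formOfCoeffs d
  have h1 := K.finrank_range_add_finrank_ker
  rw [Module.finrank_fintype_fun_eq_card, Fintype.card_coe, card_degPairs] at h1
  have h2 : Module.finrank ℂ (LinearMap.range K) ≤ 4 * s + 6 := by
    refine (Submodule.finrank_le _).trans ?_
    simp [Module.finrank_prod, Module.finrank_pi_fintype, mul_comm]
  have h3 : Module.finrank ℂ (LinearMap.ker K) ≤ Module.finrank ℂ (gradedPart c.ideal d) := by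
    refine LinearMap.finrank_le_finrank_of_injective
      (f := ((formOfCoeffs d).domRestrict (LinearMap.ker K)).codRestrict _ ?_) ?_
    · rintro ⟨v, hv⟩
      rw [LinearMap.mem_ker] at hv
      have hv1 := congrArg Prod.fst hv
      have hv2 := congrArg Prod.snd hv
      have hh := formOfCoeffs_isHomogeneous v
      exact ⟨⟨(Submodule.mem_iInf _).2 fun i => hκ i _ hh (congrFun hv1 i), hμ _ hh hv2⟩,
        (mem_homogeneousSubmodule d _).2 hh⟩
    · intro a b h
      have h4 : formOfCoeffs d a = formOfCoeffs d b := congrArg Subtype.val h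
      refine Subtype.ext ?_
      rw [← formCoeffs_formOfCoeffs (a : degPairs d → ℂ), h4, formCoeffs_formOfCoeffs]
  omega

/-! ### Persistence of independence in higher degrees -/

/-- Independence of linear functionals on forms passes from degree `d` to degree `d + 1` if
multiplication by a variable acts on them triangularly with diagonal entries the coordinates of
points. -/
theorem functionals_independent_succ {κ : Type*} [Fintype κ]
    {φ : κ → MvPolynomial (Fin 3) ℂ →ₗ[ℂ] ℂ} {w : κ → ℕ} {p : κ → Fin 3 → ℂ} (hp : ∀ k, p k ≠ 0)
    (h : ∀ a k, ∃ N : κ → ℂ, (∀ k', N k' ≠ 0 → w k' < w k) ∧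
      ∀ f, φ k (X a * f) = p k a * φ k f + ∑ k', N k' * φ k' f) {d : ℕ}
    (hd : ∀ c : κ → ℂ, (∀ f : MvPolynomial (Fin 3) ℂ, f.IsHomogeneous d → ∑ k, c k * φ k f = 0) →
      c = 0)
    {c : κ → ℂ}
    (hc : ∀ f : MvPolynomial (Fin 3) ℂ, f.IsHomogeneous (d + 1) → ∑ k, c k * φ k f = 0) :
    c = 0 := by
  classical
  choose N hN hφ using h
  by_contra hne
  obtain ⟨k₀, hk₀⟩ := Function.ne_iff.1 hne
  obtain ⟨k, hk, hmax⟩ := Finset.exists_max_image (univ.filter fun k => c k ≠ 0) w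
    ⟨k₀, by simpa using hk₀⟩
  have hk' : c k ≠ 0 := (mem_filter.1 hk).2
  refine hp k (funext fun a => ?_)
  -- Testing on multiples of `X a` turns the relation into one of degree d. As `k` has maximal
  -- weight among the nonzero coefficients, no off-diagonal term reaches it, and its new coefficient
  -- is `c k * p k a`.
  have h1 := hd (fun k' => c k' * p k' a + ∑ l, c l * N a l k') fun f hf => by
    have h2 := hc (X a * f) (by simpa [add_comm] using (isHomogeneous_X ℂ a).mul hf)
    simp only [hφ, mul_add, Finset.sum_add_distrib, Finset.mul_sum] at h2
    simp only [add_mul, Finset.sum_add_distrib, Finset.sum_mul]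
    rw [← h2, Finset.sum_comm (s := univ)]
    congr 1
    · exact Finset.sum_congr rfl fun _ _ => by ring
    · exact Finset.sum_congr rfl fun _ _ => Finset.sum_congr rfl fun _ _ => by ring
  have h3 := congrFun h1 k
  have h4 : ∑ l, c l * N a l k = 0 := by
    refine Finset.sum_eq_zero fun l _ => ?_
    by_contra h5
    have h6 := hN a l k (right_ne_zero_of_mul h5)
    have h7 := hmax l (by simpa using left_ne_zero_of_mul h5)
    omega
  simp only [h4, add_zero] at h3
  exact (mul_eq_zero.1 h3).resolve_left hk'

theorem squareFunctional_X_mul (l : Fin 2 → Fin 3 → ℂ) (a : Fin 3) (k : Fin 4) :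
    ∃ N : Fin 4 → ℂ, (∀ k', N k' ≠ 0 → (![0, 1, 1, 2] : Fin 4 → ℕ) k' < ![0, 1, 1, 2] k) ∧
      ∀ f, squareFunctional l k (X a * f) =
        crossProduct (l 0) (l 1) a * squareFunctional l k f +
          ∑ k', N k' * squareFunctional l k' f := by
  let u := crossProduct (l 1) ![0, 0, 1]
  let v := crossProduct (l 0) ![0, 0, 1]
  refine ⟨(![0, ![u a, 0, 0, 0], ![v a, 0, 0, 0], ![0, v a, u a, 0]] : Fin 4 → Fin 4 → ℂ) k,
    ?_, fun f => ?_⟩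
  · intro k'
    fin_cases k <;> fin_cases k' <;> simp
  · simp only [squareFunctional, Fin.sum_univ_four]
    fin_cases k <;> simp [Derivation.leibniz, dirDeriv_X, u, v] <;> ring

theorem tripleFunctional_X_mul (q : Fin 3 → ℂ) (a : Fin 3) (k : Fin 6) :
    ∃ N : Fin 6 → ℂ,
      (∀ k', N k' ≠ 0 → (![0, 1, 1, 2, 2, 2] : Fin 6 → ℕ) k' < ![0, 1, 1, 2, 2, 2] k) ∧
      ∀ f, tripleFunctional q k (X a * f) =
        q a * tripleFunctional q k f + ∑ k', N k' * tripleFunctional q k' f := by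
  let x : ℂ := if a = 0 then 1 else 0
  let z : ℂ := if a = 2 then 1 else 0
  refine ⟨(![0, ![x, 0, 0, 0, 0, 0], ![z, 0, 0, 0, 0, 0], ![0, 2 * x, 0, 0, 0, 0],
    ![0, z, x, 0, 0, 0], ![0, 0, 2 * z, 0, 0, 0]] : Fin 6 → Fin 6 → ℂ) k, ?_, fun f => ?_⟩
  · intro k'
    fin_cases k <;> fin_cases k' <;> simp
  · simp only [tripleFunctional, Fin.sum_univ_six]
    fin_cases a <;> fin_cases k <;> simp [Derivation.leibniz, pderiv_X, x, z] <;> ring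

/-- The functionals of a configuration are independent on forms of degree `d`. -/
def Config.IndependentIn {s : ℕ} (c : Config s) (d : ℕ) : Prop :=
  ∀ b : (Fin s × Fin 4) ⊕ Fin 6 → ℂ,
    (∀ f : MvPolynomial (Fin 3) ℂ, f.IsHomogeneous d → ∑ k, b k * c.functional k f = 0) → b = 0

theorem Config.support_ne_zero {s : ℕ} (c : Config s) (i : Fin s) : c.support i ≠ 0 := by
  rw [Config.support, crossProduct_ne_zero_iff_linearIndependent]
  have h2 : c.lines i = ![c.lines i 0, c.lines i 1] := by
    ext k
    fin_cases k <;> rfl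
  rw [← h2]
  exact c.lines_indep i

theorem Config.IndependentIn.succ {s : ℕ} {c : Config s} {d : ℕ} (h : c.IndependentIn d) :
    c.IndependentIn (d + 1) := by
  intro b hb
  refine functionals_independent_succ (φ := c.functional)
    (w := Sum.elim (fun r => (![0, 1, 1, 2] : Fin 4 → ℕ) r.2) ![0, 1, 1, 2, 2, 2])
    (p := Sum.elim (fun r => c.support r.1) fun _ => c.Q) ?_ ?_ h hb
  · rintro (r | k)
    exacts [c.support_ne_zero r.1, c.Q_ne_zero]
  · rintro a (⟨i, k⟩ | k)
    · obtain ⟨N, hN, hφ⟩ := squareFunctional_X_mul (c.lines i) a k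
      refine ⟨Sum.elim (fun r => if r.1 = i then N r.2 else 0) fun _ => 0, ?_, fun f => ?_⟩
      · rintro (⟨j, l⟩ | l) hl
        · simp only [Sum.elim_inl, ne_eq, ite_eq_right_iff, Classical.not_imp] at hl
          exact hN l hl.2
        · simp at hl
      · simp only [Config.functional, Sum.elim_inl, Fintype.sum_sum_type, Sum.elim_inr, zero_mul,
          Finset.sum_const_zero, add_zero, hφ, Config.support, Fintype.sum_prod_type, ite_mul]
        rw [Finset.sum_comm]
        simp
    · obtain ⟨N, hN, hφ⟩ := tripleFunctional_X_mul c.Q a k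
      refine ⟨Sum.elim (fun _ => 0) N, ?_, fun f => ?_⟩
      · rintro (l | l) hl
        · simp at hl
        · exact hN l hl
      · simp [Config.functional, hφ]

theorem Config.independentIn_iff {s : ℕ} (c : Config s) (d : ℕ) :
    c.IndependentIn d ↔ 4 * s + 6 ≤ (c.conditionMatrix d).rank := by
  have h1 : c.IndependentIn d ↔ LinearIndependent ℂ (c.conditionMatrix d).row := by
    rw [Fintype.linearIndependent_iff]
    have h2 : ∀ b : (Fin s × Fin 4) ⊕ Fin 6 → ℂ,
        (∀ f : MvPolynomial (Fin 3) ℂ, f.IsHomogeneous d → ∑ k, b k * c.functional k f = 0) ↔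
        ∑ k, b k • (c.conditionMatrix d).row k = 0 := by
      intro b
      constructor
      · intro h
        ext m
        simpa [Config.conditionMatrix] using h _ (degMonomial_isHomogeneous m)
      · intro h f hf
        rw [← formOfCoeffs_formCoeffs hf]
        simp only [← c.conditionMatrix_mulVec]
        have h3 : Matrix.vecMul b (c.conditionMatrix d) = 0 := by
          rw [← h]
          ext m
          simp [Matrix.vecMul, dotProduct]
        change b ⬝ᵥ (c.conditionMatrix d).mulVec _ = 0
        rw [Matrix.dotProduct_mulVec, h3, zero_dotProduct]
    simp only [Config.IndependentIn, h2, _root_.funext_iff, Pi.zero_apply]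
  rw [h1, linearIndependent_iff_card_le_finrank_span, Matrix.rank_eq_finrank_span_row,
    Set.finrank]
  simp [mul_comm]

/-! ### Maximal rank and the dimension formula -/

theorem Config.holdsForGeneral_maximal_rank {s d : ℕ} (h : (s, d) ≠ (1, 3)) :
    HoldsForGeneral fun c : Config s =>
      min ((d + 2).choose 2) (4 * s + 6) ≤ (c.conditionMatrix d).rank := by
  refine (Config.holdsForGeneral_le_rank (imposesConditions_triangle h)).mono fun c hc => ?_
  refine le_trans ?_ hc
  have h1 := card_truncatedTriangle d
  by_cases hd : 2 ≤ d
  · have h2 := card_corner d hd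
    omega
  · have h2 : truncatedTriangle d 0 0 0 = ∅ := by
      refine Finset.eq_empty_of_forall_notMem fun m hm => ?_
      have := (mem_truncatedTriangle.1 hm).2.1
      omega
    rw [h2, card_empty] at h1
    omega

theorem Config.finrank_gradedPart_eq {s : ℕ} {c : Config s} {d : ℕ}
    (h : min ((d + 2).choose 2) (4 * s + 6) ≤ (c.conditionMatrix d).rank) :
    (Module.finrank ℂ (gradedPart c.ideal d) : ℤ) =
      max (((d + 2).choose 2 : ℤ) - 4 * (s : ℤ) - 6) 0 := by
  have h1 := c.finrank_add_rank_le d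
  have h2 := c.le_finrank_add d
  omega

theorem lt_choose_two (n : ℕ) : n < (n + 2).choose 2 := by
  rw [Nat.choose_succ_succ', Nat.choose_one_right]
  omega

theorem holdsForGeneral_finrank (s : ℕ) : HoldsForGeneral fun c : Config s =>
    ∀ d : ℕ, (s, d) ≠ (1, 3) →
      (Module.finrank ℂ (gradedPart c.ideal d) : ℤ) =
        max (((d + 2).choose 2 : ℤ) - 4 * (s : ℤ) - 6) 0 := by
  refine (HoldsForGeneral.finset_forall ((range (4 * s + 7)).filter fun d => (s, d) ≠ (1, 3))
    fun d hd => Config.holdsForGeneral_maximal_rank (mem_filter.1 hd).2).mono fun c hc d hd => ?_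
  refine Config.finrank_gradedPart_eq ?_
  rcases le_or_gt d (4 * s + 6) with h | h
  · exact hc d (mem_filter.2 ⟨mem_range.2 (by omega), hd⟩)
  · refine (min_le_right _ _).trans ((c.independentIn_iff d).1 ?_)
    refine Nat.le_induction (P := fun d _ => c.IndependentIn d) ?_ (fun d _ h => h.succ) d h.le
    rw [c.independentIn_iff]
    -- In this degree there are more monomials than conditions, so maximal rank means independence,
    -- which then propagates upwards.
    have h1 := hc (4 * s + 6) (mem_filter.2 ⟨mem_range.2 (by omega), by simp⟩)
    have h2 := lt_choose_two (4 * s + 6)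
    omega

/-! ### The exceptional cubics -/

theorem linearForm_ne_zero {a : Fin 3 → ℂ} (ha : a ≠ 0) : linearForm a ≠ 0 := by
  obtain ⟨k, hk⟩ := Function.ne_iff.1 ha
  intro h
  have := eval_linearForm (Pi.single k 1) a
  rw [h, map_zero, dotProduct_single_one] at this
  exact hk this.symm

theorem exists_line_through (p q : Fin 3 → ℂ) :
    ∃ a : Fin 3 → ℂ, a ≠ 0 ∧ a ⬝ᵥ p = 0 ∧ a ⬝ᵥ q = 0 := by
  have h := (Matrix.of ![p, q]).mulVecLin.finrank_range_add_finrank_ker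
  have h1 : Module.finrank ℂ (LinearMap.range (Matrix.of ![p, q]).mulVecLin) ≤ 2 :=
    (Submodule.finrank_le _).trans (by simp)
  rw [Module.finrank_fintype_fun_eq_card, Fintype.card_fin] at h
  obtain ⟨⟨a, ha⟩, hne⟩ := (Module.finrank_pos_iff_exists_ne_zero (R := ℂ)
    (M := LinearMap.ker (Matrix.of ![p, q]).mulVecLin)).1 (by omega)
  rw [LinearMap.mem_ker, Matrix.mulVecLin_apply] at ha
  refine ⟨a, fun h => hne (Subtype.ext h), ?_, ?_⟩
  · rw [dotProduct_comm]
    exact congrFun ha 0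
  · rw [dotProduct_comm]
    exact congrFun ha 1

/-- A line through the support is a combination of the two given lines, and every cubic monomial in
two forms contains the square of one of them. -/
theorem linearForm_cube_mem_twoSquareIdeal {l : Fin 2 → Fin 3 → ℂ} (hl : LinearIndependent ℂ l)
    {a : Fin 3 → ℂ} (ha : a ⬝ᵥ crossProduct (l 0) (l 1) = 0) :
    linearForm a ^ 3 ∈ twoSquareIdeal l := by
  obtain ⟨x, y, rfl⟩ : ∃ x y : ℂ, a = x • l 0 + y • l 1 := by
    have h1 : ¬ LinearIndependent ℂ ![a, l 0, l 1] := by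
      intro h
      have h2 := (Matrix.linearIndependent_rows_iff_isUnit (A := Matrix.of ![a, l 0, l 1])).1 h
      rw [Matrix.isUnit_iff_isUnit_det, isUnit_iff_ne_zero] at h2
      rw [triple_product_eq_det] at ha
      exact h2 ha
    have h2 : l = ![l 0, l 1] := by
      ext k
      fin_cases k <;> rfl
    rw [h2] at hl
    have h3 : a ∈ Submodule.span ℂ (Set.range ![l 0, l 1]) := by
      by_contra h4
      exact h1 (linearIndependent_finCons.2 ⟨hl, h4⟩)
    obtain ⟨c, hc⟩ := (Submodule.mem_span_range_iff_exists_fun ℂ).1 h3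
    exact ⟨c 0, c 1, by simpa [Fin.sum_univ_two] using hc.symm⟩
  have h1 : linearForm (x • l 0 + y • l 1) =
      C x * linearForm (l 0) + C y * linearForm (l 1) := by
    simp only [linearForm, Finset.mul_sum, ← Finset.sum_add_distrib]
    exact Finset.sum_congr rfl fun j _ => by simp; ring
  rw [h1]
  refine Ideal.mem_span_pair.2 ⟨C x ^ 3 * linearForm (l 0) + 3 * C x ^ 2 * C y * linearForm (l 1),
    3 * C x * C y ^ 2 * linearForm (l 0) + C y ^ 3 * linearForm (l 1), ?_⟩
  ring

theorem linearForm_cube_mem_gradedPart (c : Config 1) {a : Fin 3 → ℂ}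
    (hp : eval (c.support 0) (linearForm a) = 0) (hq : eval c.Q (linearForm a) = 0) :
    linearForm a ^ 3 ∈ gradedPart c.ideal 3 := by
  rw [eval_linearForm] at hp hq
  refine ⟨⟨(Submodule.mem_iInf _).2 fun i => ?_, ?_⟩, ?_⟩
  · rw [Subsingleton.elim i 0]
    exact linearForm_cube_mem_twoSquareIdeal (c.lines_indep 0) hp
  · exact Ideal.pow_mem_pow (linearForm_mem_pointIdeal hq) 3
  · simpa using (linearForm_isHomogeneous a).pow 3

/-- Generically the rank is at least 6 + 3 = 9 out of 10, so the dimension is at most 1, and the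
nonzero cube of the line attains it. -/
theorem holdsForGeneral_cubics : HoldsForGeneral fun c : Config 1 =>
    Module.finrank ℂ (gradedPart c.ideal 3) = 1 ∧
      ∀ a : Fin 3 → ℂ, a ≠ 0 → eval (c.support 0) (linearForm a) = 0 →
        eval c.Q (linearForm a) = 0 →
        gradedPart c.ideal 3 = Submodule.span ℂ {linearForm a ^ 3} := by
  refine (Config.holdsForGeneral_le_rank imposesConditions_cubics).mono fun c hc => ?_
  rw [card_corner 3 (by omega)] at hc
  have h1 := c.finrank_add_rank_le 3
  have h2 : (3 + 2).choose 2 = 10 := rfl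
  have h3 : ∀ a : Fin 3 → ℂ, a ≠ 0 → eval (c.support 0) (linearForm a) = 0 →
      eval c.Q (linearForm a) = 0 →
      gradedPart c.ideal 3 = Submodule.span ℂ {linearForm a ^ 3} := fun a ha hp hq => by
    symm
    refine Submodule.eq_of_le_of_finrank_le ?_ ?_
    · rw [Submodule.span_singleton_le_iff_mem]
      exact linearForm_cube_mem_gradedPart c hp hq
    · rw [finrank_span_singleton (pow_ne_zero 3 (linearForm_ne_zero ha))]
      omega
  refine ⟨?_, h3⟩
  obtain ⟨a, ha, hp, hq⟩ := exists_line_through (c.support 0) c.Q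
  rw [h3 a ha (by rw [eval_linearForm, hp]) (by rw [eval_linearForm, hq]),
    finrank_span_singleton (pow_ne_zero 3 (linearForm_ne_zero ha))]

theorem mainTheorem2 :
    (∀ s : ℕ, HoldsForGeneral (fun c : Config s =>
      ∀ d : ℕ, (s, d) ≠ (1, 3) →
        (Module.finrank ℂ (gradedPart c.ideal d) : ℤ) =
          max (((d + 2).choose 2 : ℤ) - 4 * (s : ℤ) - 6) 0)) ∧
    HoldsForGeneral (fun c : Config 1 =>
      Module.finrank ℂ (gradedPart c.ideal 3) = 1 ∧
      ∀ a : Fin 3 → ℂ, a ≠ 0 →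
        MvPolynomial.eval (c.support 0) (linearForm a) = 0 →
        MvPolynomial.eval c.Q (linearForm a) = 0 →
        gradedPart c.ideal 3 = Submodule.span ℂ {linearForm a ^ 3}) :=
  ⟨holdsForGeneral_finrank, holdsForGeneral_cubics⟩
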